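/- There exist constants $c,C>0$ such that for all $0<h\le k$ and all $v\in H^1(0,h)$ $$ c\,\big(k^2\|v'\|_{L_2(0,h)}^2+\|v\|_{L_2(0,h)}^2\big)\;\le\; k^2\|v'\|_{L_2(0,h)}^2+h\,|v(0)|^2\;\le\; C\,\big(k^2\|v'\|_{L_2(0,h)}^2+\|v\|_{L_2(0,h)}^2\big). \qquad (1) $$ Every pair of constants $c,C>0$ for which (1) holds has the following property. Let $K\subset\mathbb R^n$ be a bounded Lipschitz domain with outer unit normal $\mathbf n_K$ (defined almost everywhere on $\partial K$), let $0\ne\mathbf b\in\mathbb R^n$ be a constant vector, put $$\partial K_{\pm}=\{s\in\partial K:\ \pm\,\mathbf b\cdot\mathbf n_K(s)>0\},\qquad H(\mathbf b;K)=\{v\in L_2(K):\ \partial_{\mathbf b}v=\mathbf b\cdot\nabla v\in L_2(K)\},$$ with $\mathbf b\cdot\nabla v$ taken in the weak sense, and for $s\in\partial K_-$ let $r(s)=\inf\{t>0:\ s+t\,\mathbf b/|\mathbf b|\in\partial K_+\}$ be the distance from $s$ to $\partial K_+$ along $\mathbf b$. Let $q_K\ge|\mathbf b|^{-1}\operatorname{diam}(K)$.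 Then for every $v\in H(\mathbf b;K)$ the trace of $v$ on $\partial K_-$ exists, that is, for almost every $s\in\partial K_-$ the function $t\mapsto v(s+t\,\mathbf b/|\mathbf b|)$ agrees almost everywhere on $(0,r(s))$ with a continuous function on $[0,r(s)]$, whose value at $t=0$ is denoted by $v(s)$; the function $s\mapsto |v(s)|^2\,\big|\tfrac{\mathbf b}{|\mathbf b|}\cdot\mathbf n_K(s)\big|\,r(s)$ is integrable over $\partial K_-$ with respect to surface measure; and $$ \begin{aligned} c\,\big(q_K^2\|\partial_{\mathbf b}v\|_{L_2(K)}^2+\|v\|_{L_2(K)}^2\big) &\le q_K^2\|\partial_{\mathbf b}v\|_{L_2(K)}^2+\int_{\partial K_-}|v(s)|^2\,\Big|\frac{\mathbf b}{|\mathbf b|}\cdot\mathbf n_K(s)\Big|\,r(s)\,ds\\ &\le C\,\big(q_K^2\|\partial_{\mathbf b}v\|_{L_2(K)}^2+\|v\|_{L_2(K)}^2\big). \end{aligned} $$ In particular the equivalence constants do not depend on $n$, $K$, $\mathbf b$, $q_K$ or $v$. -/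

import Mathlib

open MeasureTheory Set Filter Topology
open scoped ContDiff

namespace Transport

noncomputable section

/-- A bounded Lipschitz domain `K`: a bounded, connected (hence nonempty), open set which, near each
boundary point and in a suitable direction `e`, is the set of points strictly above the graph of a
Lipschitz function `ψ` on the hyperplane orthogonal to `e`. -/
structure IsLipschitzDomain {E : Type*} [NormedAddCommGroup E] [InnerProductSpace ℝ E]
    (K : Set E) : Prop where
  isOpen : IsOpen K
  isConnected : IsConnected K
  isBounded : Bornology.IsBounded K
  exists_graph : ∀ x ∈ frontier K, ∃ e : E, ‖e‖ = 1 ∧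
    ∃ (L : NNReal) (ψ : (Submodule.span ℝ {e})ᗮ → ℝ), LipschitzWith L ψ ∧
      ∃ U ∈ 𝓝 x, ∀ y ∈ U,
        (y ∈ K ↔ ψ ((Submodule.span ℝ {e})ᗮ.orthogonalProjectionOnto y) < inner ℝ e y)

/-- `ν` is the outer unit normal to `K` at the boundary point `s`: up to first order at `s`, the set
`K` is the half-space `{y | ⟪y - s, ν⟫ < 0}`. -/
def IsOuterNormal {E : Type*} [NormedAddCommGroup E] [InnerProductSpace ℝ E]
    (K : Set E) (s ν : E) : Prop :=
  ‖ν‖ = 1 ∧ ∀ ε > 0, ∀ᶠ y in 𝓝 s,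
    (inner ℝ (y - s) ν < -(ε * ‖y - s‖) → y ∈ K) ∧
    (ε * ‖y - s‖ < inner ℝ (y - s) ν → y ∉ K)

/-- The outer unit normal is unique where it exists. -/
theorem IsOuterNormal.unique {E : Type*} [NormedAddCommGroup E] [InnerProductSpace ℝ E]
    {K : Set E} {s ν ν' : E} (h : IsOuterNormal K s ν) (h' : IsOuterNormal K s ν') : ν = ν' := by
  by_contra hne
  have hlt : inner ℝ ν ν' < 1 :=
    (inner_lt_one_iff_real_of_norm_eq_one h.1 h'.1).2 hne
  have hd : 0 < ‖ν' - ν‖ := norm_pos_iff.2 (sub_ne_zero.2 (Ne.symm hne))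
  set a : ℝ := 1 - inner ℝ ν ν' with ha
  have hapos : 0 < a := by linarith
  set ε : ℝ := a / (2 * ‖ν' - ν‖) with hε
  have hεpos : 0 < ε := by positivity
  have hεd : ε * ‖ν' - ν‖ = a / 2 := by rw [hε]; field_simp
  have i1 : inner ℝ (ν' - ν) ν = -a := by
    rw [inner_sub_left, real_inner_self_eq_norm_sq, h.1, real_inner_comm, ha]; ring
  have i2 : inner ℝ (ν' - ν) ν' = a := by
    rw [inner_sub_left, real_inner_self_eq_norm_sq, h'.1, ha]; ring
  have hT : Tendsto (fun t : ℝ => s + t • (ν' - ν)) (𝓝[>] 0) (𝓝 s) := by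
    have : Tendsto (fun t : ℝ => s + t • (ν' - ν)) (𝓝 0) (𝓝 (s + (0 : ℝ) • (ν' - ν))) :=
      Continuous.tendsto (by fun_prop) 0
    rw [zero_smul, add_zero] at this
    exact this.mono_left nhdsWithin_le_nhds
  have hev := (hT.eventually (h.2 ε hεpos)).and
    ((hT.eventually (h'.2 ε hεpos)).and self_mem_nhdsWithin)
  obtain ⟨t, h1, h2, ht⟩ := hev.exists
  have ht : 0 < t := ht
  simp only [add_sub_cancel_left, inner_smul_left, norm_smul, Real.norm_eq_abs, abs_of_pos ht,
    i1, i2, conj_trivial] at h1 h2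
  have e1 : ε * (t * ‖ν' - ν‖) = t * (a / 2) := by rw [← hεd]; ring
  rw [e1] at h1 h2
  have hta : 0 < t * a := mul_pos ht hapos
  exact h2.2 (by linarith) (h1.1 (by linarith))

open Classical in
/-- The outer unit normal `n_K(s)`; by convention `0` where no normal exists (for a Lipschitz domain
this happens only on a part of the boundary of surface measure zero). -/
def outerNormal {E : Type*} [NormedAddCommGroup E] [InnerProductSpace ℝ E]
    (K : Set E) (s : E) : E :=
  if h : ∃ ν, IsOuterNormal K s ν then h.choose else 0

theorem IsOuterNormal.outerNormal_eq {E : Type*} [NormedAddCommGroup E] [InnerProductSpace ℝ E]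
    {K : Set E} {s ν : E} (h : IsOuterNormal K s ν) : outerNormal K s = ν := by
  have hex : ∃ ν, IsOuterNormal K s ν := ⟨ν, h⟩
  unfold outerNormal
  rw [dif_pos hex]
  exact hex.choose_spec.unique h

/-- The inflow boundary `∂K₋` for the constant field `b`. -/
def inflow {E : Type*} [NormedAddCommGroup E] [InnerProductSpace ℝ E] (b : E) (K : Set E) :
    Set E :=
  {s ∈ frontier K | inner ℝ b (outerNormal K s) < 0}

/-- The outflow boundary `∂K₊` for the constant field `b`. -/
def outflow {E : Type*} [NormedAddCommGroup E] [InnerProductSpace ℝ E] (b : E) (K : Set E) :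
    Set E :=
  {s ∈ frontier K | 0 < inner ℝ b (outerNormal K s)}

/-- The unit vector `b / |b|`. -/
def direction {E : Type*} [NormedAddCommGroup E] [InnerProductSpace ℝ E] (b : E) : E :=
  ‖b‖⁻¹ • b

/-- `r(s)`, the distance from `s` to the outflow boundary along `b`, i.e. the length of the
characteristic that enters `K` at `s ∈ ∂K₋`. -/
def charLength {E : Type*} [NormedAddCommGroup E] [InnerProductSpace ℝ E] (b : E) (K : Set E)
    (s : E) : ℝ :=
  sInf {t : ℝ | 0 < t ∧ s + t • direction b ∈ outflow b K}

/-- `w` is the weak directional derivative `∂_b v` (i.e. `b · ∇ v`) of `v` in the open set `U`. -/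
def HasWeakDirDeriv {E : Type*} [NormedAddCommGroup E] [NormedSpace ℝ E] [MeasureSpace E]
    (b : E) (U : Set E) (v w : E → ℝ) : Prop :=
  ∀ φ : E → ℝ, ContDiff ℝ ∞ φ → HasCompactSupport φ → tsupport φ ⊆ U →
    ∫ x in U, v x * fderiv ℝ φ x b = - ∫ x in U, w x * φ x

/-- `v` belongs to `H(b; U) = {v ∈ L₂(U) : ∂_b v ∈ L₂(U)}`, and `w` is its derivative `∂_b v`. -/
structure MemH {E : Type*} [NormedAddCommGroup E] [NormedSpace ℝ E] [MeasureSpace E]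
    (b : E) (U : Set E) (v w : E → ℝ) : Prop where
  memLp : MemLp v 2 (volume.restrict U)
  memLp_deriv : MemLp w 2 (volume.restrict U)
  hasWeakDirDeriv : HasWeakDirDeriv b U v w

/-- The pair of constants `c, C` realizes the one-dimensional equivalence
`k² ‖v'‖² + ‖v‖² ≂ k² ‖v'‖² + h |v(0)|²` in `L₂(0,h)`, uniformly in `0 < h ≤ k` and `v ∈ H¹(0,h)`.
The functions `v` are the continuous representatives on `[0,h]`, which gives `v(0)` its meaning. -/
def IntervalEquiv (c C : ℝ) : Prop :=
  0 < c ∧ 0 < C ∧ ∀ h k : ℝ, 0 < h → h ≤ k → ∀ v v' : ℝ → ℝ,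
    MemH 1 (Ioo 0 h) v v' → ContinuousOn v (Icc 0 h) →
      c * (k ^ 2 * (∫ x in Ioo 0 h, v' x ^ 2) + ∫ x in Ioo 0 h, v x ^ 2)
        ≤ k ^ 2 * (∫ x in Ioo 0 h, v' x ^ 2) + h * v 0 ^ 2 ∧
      k ^ 2 * (∫ x in Ioo 0 h, v' x ^ 2) + h * v 0 ^ 2
        ≤ C * (k ^ 2 * (∫ x in Ioo 0 h, v' x ^ 2) + ∫ x in Ioo 0 h, v x ^ 2)

/-- The surface measure `ds` on the inflow boundary `∂K₋ ⊆ ℝⁿ`: the `(n-1)`-dimensional Hausdorff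
measure, normalized so as to agree with Lebesgue measure on `ℝⁿ⁻¹`. -/
def inflowMeasure {n : ℕ} (b : EuclideanSpace ℝ (Fin n)) (K : Set (EuclideanSpace ℝ (Fin n))) :
    Measure (EuclideanSpace ℝ (Fin n)) :=
  (Measure.euclideanHausdorffMeasure (n - 1)).restrict (inflow b K)

/-- `g` is the trace of `v` on `∂K₋`: for almost every `s ∈ ∂K₋`, `g s` is the value at `s` of the
continuous representative of `v` along the characteristic from `s` to the outflow boundary. -/
def IsInflowTrace {n : ℕ} (b : EuclideanSpace ℝ (Fin n)) (K : Set (EuclideanSpace ℝ (Fin n)))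
    (v g : EuclideanSpace ℝ (Fin n) → ℝ) : Prop :=
  ∀ᵐ s ∂(inflowMeasure b K), ∃ f : ℝ → ℝ, ContinuousOn f (Icc 0 (charLength b K s)) ∧
    (∀ᵐ t ∂(volume.restrict (Ioo 0 (charLength b K s))), v (s + t • direction b) = f t) ∧
    f 0 = g s

/-- The weight `|(b/|b|) · n_K(s)| r(s)`. -/
def inflowWeight {E : Type*} [NormedAddCommGroup E] [InnerProductSpace ℝ E] (b : E) (K : Set E)
    (s : E) : ℝ :=
  |inner ℝ (direction b) (outerNormal K s)| * charLength b K s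

end

end Transport

namespace Transport

set_option linter.unusedSectionVars false

/-! ### Hausdorff measure of projected sets: the linear and the nearly linear case. -/

section Area

open Measure Module
open scoped NNReal ENNReal RealInnerProductSpace

/-! The domain is cut into segments parallel to `b`, the one-dimensional equivalence is applied on
each of them, and the result is integrated. Nothing is lost on the way, so every admissible
one-dimensional pair of constants survives unchanged.

Let `d = b/|b|`. Fubini in the splitting of the space into the line of `d` and its orthogonal
complement integrates over the lines parallel to `d`. For almost every such line, all boundary
points on it have a normal that is not orthogonal to `d`: non-differentiability points of the
boundary graphs are null by Rademacher, and points where `d` is tangent project to a null set by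
Sard. On such a line `K` is a disjoint union of segments, each entering at an inflow point `s` and
leaving at the first outflow point, so with length `r(s)`. The projection of the inflow boundary
along `d` has Jacobian `|d · n_K|` (`projection_area_formula`), and hence `∫_K F = ∫_{∂K₋} |d ·
n_K(s)| ∫_0^{r(s)} F(s + t d) dt ds` for measurable nonnegative `F`. This is
`IsLipschitzDomain.exists_characteristic_decomposition`, and it explains the weight in the trace
norm.

Testing the weak derivative against translates of a test function shows that on almost every line
`v` is almost everywhere a primitive of its derivative (`ae_ae_increment_eq`). So on almost every
characteristic `v` has a continuous representative in `H¹(0, r(s))`, whose value at `0` is the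
trace. The one-dimensional equivalence with `h = r(s)` and `k = q|b| ≥ diam K ≥ r(s)`, multiplied by
`|d · n_K(s)|` and integrated over `s`, gives both inequalities (`IsCharDecomposition.trace_equiv`).

In one dimension, `v(t) = v(0) + ∫_0^t v'` and Cauchy–Schwarz give the constants `1/3` and `3`
(`intervalEquiv_third_three`). -/

theorem euclideanHausdorffMeasure_image_le_of_dist_le {α X Y : Type*}
    [MetricSpace X] [MeasurableSpace X] [BorelSpace X]
    [MetricSpace Y] [MeasurableSpace Y] [BorelSpace Y] (m : ℕ) (s : Set α) (f : α → X) (g : α → Y)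
    (K : ℝ≥0) (h : ∀ x ∈ s, ∀ y ∈ s, dist (f x) (f y) ≤ K * dist (g x) (g y)) :
    (μHE[m] : Measure X) (f '' s) ≤ (K : ℝ≥0∞) ^ m * (μHE[m] : Measure Y) (g '' s) := by
  classical
  rcases s.eq_empty_or_nonempty with rfl | ⟨a, ha⟩
  · simp
  have : Nonempty α := ⟨a⟩
  -- On `s` the map `f` factors through `g`, because points with equal `g` have equal `f`; the
  -- factor is `K`-Lipschitz on `g '' s`.
  have hinv : ∀ x ∈ s, f (Function.invFunOn g s (g x)) = f x := by
    intro x hx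
    have h1 : Function.invFunOn g s (g x) ∈ s := Function.invFunOn_apply_mem hx
    have h2 : g (Function.invFunOn g s (g x)) = g x := Function.invFunOn_apply_eq hx
    have := h _ h1 _ hx
    rw [h2, dist_self, mul_zero] at this
    exact dist_le_zero.1 this
  have himg : f '' s = (fun y => f (Function.invFunOn g s y)) '' (g '' s) := by
    rw [image_image]
    exact image_congr fun x hx => (hinv x hx).symm
  have hlip : LipschitzOnWith K (fun y => f (Function.invFunOn g s y)) (g '' s) := by
    apply LipschitzOnWith.of_dist_le_mul
    rintro _ ⟨x, hx, rfl⟩ _ ⟨y, hy, rfl⟩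
    simp only [hinv x hx, hinv y hy]
    exact h x hx y hy
  have := hlip.hausdorffMeasure_image_le (d := (m : ℝ)) (by positivity)
  rw [← himg] at this
  simp only [euclideanHausdorffMeasure_def, Measure.smul_apply, ENNReal.smul_def, smul_eq_mul]
  rw [ENNReal.rpow_natCast] at this
  calc _ ≤ _ := mul_le_mul_right this _
    _ = _ := by ring

variable {E : Type*} [NormedAddCommGroup E] [InnerProductSpace ℝ E]

theorem coe_orthogonalProjectionOnto_orthogonal_span {d : E} (hd : ‖d‖ = 1) (x : E) :
    ((ℝ ∙ d)ᗮ.orthogonalProjectionOnto x : E) = x - ⟪d, x⟫ • d := by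
  simp [Submodule.starProjection_unit_singleton ℝ hd]

/-- With `f` the restricted projection and `p` the component of `d` orthogonal to `ν`, `f* f = 1 - p
⊗ p`. Its determinant is `1 - ‖p‖² = ⟪d, ν⟫²`, the square of the Jacobian. -/
theorem normDet_domRestrict_orthogonalProjectionOnto [FiniteDimensional ℝ E] {d ν : E}
    (hd : ‖d‖ = 1) (hν : ‖ν‖ = 1) {W : Submodule ℝ E} (hW : W = (ℝ ∙ ν)ᗮ) :
    ((ℝ ∙ d)ᗮ.orthogonalProjectionOnto.toLinearMap.domRestrict W).normDet = |⟪d, ν⟫| := by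
  subst hW
  set f := (ℝ ∙ d)ᗮ.orthogonalProjectionOnto.toLinearMap.domRestrict (ℝ ∙ ν)ᗮ with hf
  set p : (ℝ ∙ ν)ᗮ := (ℝ ∙ ν)ᗮ.orthogonalProjectionOnto d with hp
  have hpc : (p : E) = d - ⟪ν, d⟫ • ν := coe_orthogonalProjectionOnto_orthogonal_span hν d
  have hperp : ∀ y : (ℝ ∙ ν)ᗮ, ⟪ν, (y : E)⟫ = 0 := fun y =>
    Submodule.mem_orthogonal_singleton_iff_inner_right.1 y.2
  have hdp : ∀ y : (ℝ ∙ ν)ᗮ, ⟪p, y⟫ = ⟪d, (y : E)⟫ := by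
    intro y
    rw [Submodule.coe_inner, hpc, inner_sub_left, inner_smul_left, hperp]
    simp
  have hadj : LinearMap.adjoint f ∘ₗ f
      = LinearMap.transvection (-(innerSL ℝ p).toLinearMap) p := by
    ext1 x
    refine ext_inner_right ℝ fun y => ?_
    rw [LinearMap.comp_apply, LinearMap.adjoint_inner_left]
    simp only [LinearMap.transvection, LinearMap.coe_mk, AddHom.coe_mk, LinearMap.neg_apply,
      ContinuousLinearMap.coe_coe, innerSL_apply_apply, inner_add_left, inner_smul_left, hdp,
      conj_trivial]
    rw [Submodule.coe_inner, Submodule.coe_inner, hf]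
    simp only [LinearMap.domRestrict_apply, ContinuousLinearMap.coe_coe,
      coe_orthogonalProjectionOnto_orthogonal_span hd, inner_sub_left, inner_sub_right,
      inner_smul_left, inner_smul_right, conj_trivial, real_inner_self_eq_norm_sq, hd]
    rw [real_inner_comm d (x : E)]
    ring
  have h := LinearMap.normDet_sq f
  rw [hadj, LinearMap.transvection.det] at h
  simp only [LinearMap.neg_apply, ContinuousLinearMap.coe_coe, innerSL_apply_apply, hdp, hpc,
    inner_sub_right, inner_smul_right, real_inner_self_eq_norm_sq, hd, RCLike.ofReal_real_eq_id,
    id] at h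
  rw [← abs_of_nonneg f.normDet_nonneg]
  refine (sq_eq_sq_iff_abs_eq_abs _ _).1 ?_
  rw [h, real_inner_comm d ν]
  ring

variable {M : Type*} [NormedAddCommGroup M] [InnerProductSpace ℝ M]
  [FiniteDimensional ℝ M]

theorem normDet_orthogonalProjectionOnto_comp [FiniteDimensional ℝ E] {d ν : E}
    (hd : ‖d‖ = 1) (hν : ‖ν‖ = 1)
    (hrank : finrank ℝ E = finrank ℝ M + 1) (A : M →ₗ[ℝ] E) (hinj : Function.Injective A)
    (hA : ∀ u, ⟪ν, A u⟫ = 0) :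
    ((ℝ ∙ d)ᗮ.orthogonalProjectionOnto.toLinearMap ∘ₗ A).normDet = |⟪d, ν⟫| * A.normDet := by
  have hν0 : ν ≠ 0 := by rintro rfl; simp at hν
  have hrange : A.range = (ℝ ∙ ν)ᗮ := by
    apply Submodule.eq_of_le_of_finrank_eq
    · rintro _ ⟨u, rfl⟩
      exact Submodule.mem_orthogonal_singleton_iff_inner_right.2 (hA u)
    · have : Fact (finrank ℝ E = finrank ℝ M + 1) := ⟨hrank⟩
      rw [Submodule.finrank_orthogonal_span_singleton (n := finrank ℝ M) hν0,
        LinearMap.finrank_range_of_inj hinj]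
  rw [LinearMap.normDet_comp, normDet_domRestrict_orthogonalProjectionOnto hd hν hrange]

variable [FiniteDimensional ℝ E] [MeasurableSpace E] [BorelSpace E]
  [MeasurableSpace M] [BorelSpace M]

theorem euclideanHausdorffMeasure_projection_image_linear {d ν : E}
    (hd : ‖d‖ = 1) (hν : ‖ν‖ = 1)
    (hrank : finrank ℝ E = finrank ℝ M + 1) (A : M →L[ℝ] E) (hinj : Function.Injective A)
    (hA : ∀ u, ⟪ν, A u⟫ = 0) (s : Set M) :
    (μHE[finrank ℝ M] : Measure (ℝ ∙ d)ᗮ)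
        ((fun x => (ℝ ∙ d)ᗮ.orthogonalProjectionOnto (A x)) '' s)
      = ENNReal.ofReal |⟪d, ν⟫| * (μHE[finrank ℝ M] : Measure E) (A '' s) := by
  have h1 := ((ℝ ∙ d)ᗮ.orthogonalProjectionOnto.toLinearMap
    ∘ₗ A.toLinearMap).euclideanHausdorffMeasure_image s
  have h2 := A.toLinearMap.euclideanHausdorffMeasure_image s
  rw [normDet_orthogonalProjectionOnto_comp hd hν hrank A.toLinearMap hinj hA] at h1
  have h3 : (μHE[finrank ℝ M] : Measure E) (A '' s) = _ := h2
  rw [h3, ← mul_assoc, ← ENNReal.ofReal_mul (abs_nonneg _), ← h1]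
  rfl

/-- A map that is close to a linear map distorts distances as the linear map does. -/
theorem dist_le_and_le_of_approximatesLinearOn {G : Type*} [NormedAddCommGroup G] [NormedSpace ℝ G]
    {f : M → G} {A : M →L[ℝ] G} {s : Set M} {δ lam : ℝ≥0} (hlam : 1 < lam)
    (hf : ApproximatesLinearOn f A s δ)
    (hA : ∀ u, δ * ‖u‖ ≤ (1 - (lam : ℝ)⁻¹) * ‖A u‖) {x y : M} (hx : x ∈ s) (hy : y ∈ s) :
    dist (f x) (f y) ≤ lam * dist (A x) (A y) ∧ dist (A x) (A y) ≤ lam * dist (f x) (f y) := by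
  have hl : (1 : ℝ) < lam := by exact_mod_cast hlam
  have h1 := hf x hx y hy
  have h2 := hA (x - y)
  rw [dist_eq_norm, dist_eq_norm, ← map_sub]
  have h3 : ‖f x - f y‖ ≤ ‖f x - f y - A (x - y)‖ + ‖A (x - y)‖ := by
    simpa using norm_add_le (f x - f y - A (x - y)) (A (x - y))
  have h4 : ‖A (x - y)‖ ≤ ‖f x - f y‖ + ‖f x - f y - A (x - y)‖ := by
    simpa using norm_sub_le (f x - f y) (f x - f y - A (x - y))
  have h5 : (lam : ℝ)⁻¹ * lam = 1 := inv_mul_cancel₀ (by positivity)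
  -- Equivalent to `(lam - 1)² ≥ 0` after division by `lam`. Thus the one tolerance `1 - lam⁻¹`
  -- serves for both inequalities.
  have h6 : 2 - (lam : ℝ)⁻¹ ≤ lam := by
    have : (lam : ℝ)⁻¹ * ((lam : ℝ) - 1) ^ 2 = lam - 2 + (lam : ℝ)⁻¹ := by
      field_simp
      ring
    have : 0 ≤ (lam : ℝ)⁻¹ * ((lam : ℝ) - 1) ^ 2 := by positivity
    linarith
  constructor
  · calc ‖f x - f y‖ ≤ (2 - (lam : ℝ)⁻¹) * ‖A (x - y)‖ := by linarith
      _ ≤ lam * ‖A (x - y)‖ := mul_le_mul_of_nonneg_right h6 (norm_nonneg _)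
  · have h7 : (lam : ℝ)⁻¹ * ‖A (x - y)‖ ≤ ‖f x - f y‖ := by linarith
    calc ‖A (x - y)‖ = lam * ((lam : ℝ)⁻¹ * ‖A (x - y)‖) := by
          rw [← mul_assoc, mul_comm (lam : ℝ), h5, one_mul]
      _ ≤ _ := mul_le_mul_of_nonneg_left h7 (by positivity)

/-- For linear maps the two sides agree exactly. Replacing `f` by `A` and `P ∘ f` by `P ∘ A` costs a
factor `lam ^ m` each, which accounts for the exponent `2 * m`. The tolerance is measured against `P
∘ A`, the smaller of the two maps. -/
theorem projection_image_bounds_of_approximatesLinearOn {d ν : E} (hd : ‖d‖ = 1) (hν : ‖ν‖ = 1)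
    (hrank : finrank ℝ E = finrank ℝ M + 1) {f : M → E} {A : M →L[ℝ] E} {s : Set M}
    {δ lam : ℝ≥0} (hlam : 1 < lam) (hf : ApproximatesLinearOn f A s δ)
    (hinj : Function.Injective A) (hA : ∀ u, ⟪ν, A u⟫ = 0)
    (hδ : ∀ u, δ * ‖u‖ ≤ (1 - (lam : ℝ)⁻¹) * ‖(ℝ ∙ d)ᗮ.orthogonalProjectionOnto (A u)‖) :
    (μHE[finrank ℝ M] : Measure (ℝ ∙ d)ᗮ)
        ((fun x => (ℝ ∙ d)ᗮ.orthogonalProjectionOnto (f x)) '' s)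
      ≤ (lam : ℝ≥0∞) ^ (2 * finrank ℝ M) *
        (ENNReal.ofReal |⟪d, ν⟫| * (μHE[finrank ℝ M] : Measure E) (f '' s)) ∧
    ENNReal.ofReal |⟪d, ν⟫| * (μHE[finrank ℝ M] : Measure E) (f '' s)
      ≤ (lam : ℝ≥0∞) ^ (2 * finrank ℝ M) * (μHE[finrank ℝ M] : Measure (ℝ ∙ d)ᗮ)
        ((fun x => (ℝ ∙ d)ᗮ.orthogonalProjectionOnto (f x)) '' s) := by
  set P := (ℝ ∙ d)ᗮ.orthogonalProjectionOnto with hP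
  set m := finrank ℝ M
  have hl : (1 : ℝ) < lam := by exact_mod_cast hlam
  have hPle : ∀ z : E, ‖P z‖ ≤ ‖z‖ := fun z =>
    Submodule.norm_orthogonalProjectionOnto_apply_le _ z
  have h0 : (0 : ℝ) ≤ 1 - (lam : ℝ)⁻¹ := by
    rw [sub_nonneg]; exact inv_le_one_of_one_le₀ hl.le
  have hδ' : ∀ u, δ * ‖u‖ ≤ (1 - (lam : ℝ)⁻¹) * ‖A u‖ := fun u =>
    (hδ u).trans (mul_le_mul_of_nonneg_left (hPle _) h0)
  have hPf : ApproximatesLinearOn (fun x => P (f x)) (P ∘L A) s δ := by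
    intro x hx y hy
    have h := hf x hx y hy
    have : P (f x) - P (f y) - (P ∘L A) (x - y) = P (f x - f y - A (x - y)) := by simp
    rw [this]
    exact (hPle _).trans h
  have e1 := euclideanHausdorffMeasure_image_le_of_dist_le m s f A lam
    fun x hx y hy => (dist_le_and_le_of_approximatesLinearOn hlam hf hδ' hx hy).1
  have e2 := euclideanHausdorffMeasure_image_le_of_dist_le m s A f lam
    fun x hx y hy => (dist_le_and_le_of_approximatesLinearOn hlam hf hδ' hx hy).2
  have e3 := euclideanHausdorffMeasure_image_le_of_dist_le m s (fun x => P (f x)) (P ∘L A) lam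
    fun x hx y hy => (dist_le_and_le_of_approximatesLinearOn hlam hPf hδ hx hy).1
  have e4 := euclideanHausdorffMeasure_image_le_of_dist_le m s (P ∘L A) (fun x => P (f x)) lam
    fun x hx y hy => (dist_le_and_le_of_approximatesLinearOn hlam hPf hδ hx hy).2
  have e5 : (μHE[m] : Measure (ℝ ∙ d)ᗮ) ((P ∘L A) '' s)
      = ENNReal.ofReal |⟪d, ν⟫| * (μHE[m] : Measure E) (A '' s) :=
    euclideanHausdorffMeasure_projection_image_linear hd hν hrank A hinj hA s
  rw [e5] at e3 e4
  constructor
  · calc _ ≤ _ := e3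
      _ ≤ (lam : ℝ≥0∞) ^ m * (ENNReal.ofReal |⟪d, ν⟫|
          * ((lam : ℝ≥0∞) ^ m * (μHE[m] : Measure E) (f '' s))) := by gcongr
      _ = _ := by ring
  · calc _ ≤ ENNReal.ofReal |⟪d, ν⟫| * ((lam : ℝ≥0∞) ^ m * (μHE[m] : Measure E) (A '' s)) := by
          gcongr
      _ = (lam : ℝ≥0∞) ^ m * (ENNReal.ofReal |⟪d, ν⟫| * (μHE[m] : Measure E) (A '' s)) := by ring
      _ ≤ (lam : ℝ≥0∞) ^ m * ((lam : ℝ≥0∞) ^ m * (μHE[m] : Measure (ℝ ∙ d)ᗮ)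
        ((fun x => P (f x)) '' s)) := by gcongr
      _ = _ := by ring

/-- An injective linear map in finite dimension is bounded below. The implication is placed inside
the existential so that `δ` is a total function of `A`, as the partition into nearly linear pieces
requires. -/
theorem exists_tolerance {d : E} (lam : ℝ≥0) (hlam : 1 < lam) (A : M →L[ℝ] E) :
    ∃ δ : ℝ≥0, δ ≠ 0 ∧ (Function.Injective (fun u => (ℝ ∙ d)ᗮ.orthogonalProjectionOnto (A u)) →
      ∀ u, δ * ‖u‖ ≤ (1 - (lam : ℝ)⁻¹) * ‖(ℝ ∙ d)ᗮ.orthogonalProjectionOnto (A u)‖) := by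
  by_cases h : Function.Injective (fun u => (ℝ ∙ d)ᗮ.orthogonalProjectionOnto (A u))
  · obtain ⟨κ, hκ, hanti⟩ := LinearMap.exists_antilipschitzWith
      ((ℝ ∙ d)ᗮ.orthogonalProjectionOnto ∘L A).toLinearMap (LinearMap.ker_eq_bot.2 h)
    have hl : 0 < 1 - lam⁻¹ := tsub_pos_of_lt (inv_lt_one_of_one_lt₀ hlam)
    have hcoe : ((1 - lam⁻¹ : ℝ≥0) : ℝ) = 1 - (lam : ℝ)⁻¹ := by
      rw [NNReal.coe_sub (inv_le_one_of_one_le₀ hlam.le)]; simp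
    refine ⟨(1 - lam⁻¹) / κ, (div_pos hl hκ).ne', fun _ u => ?_⟩
    have := hanti.le_mul_dist u 0
    simp only [dist_zero_right, map_zero] at this
    have h2 : ‖u‖ ≤ κ * ‖(ℝ ∙ d)ᗮ.orthogonalProjectionOnto (A u)‖ := this
    rw [NNReal.coe_div, hcoe, div_mul_eq_mul_div, div_le_iff₀ (by exact_mod_cast hκ), mul_assoc]
    refine mul_le_mul_of_nonneg_left (by linarith) ?_
    rw [← hcoe]; positivity
  · exact ⟨1, one_ne_zero, fun h' => absurd h' h⟩

/-- If `ν` is orthogonal to the range of the injective map `A` and not to `d`, then the projection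
along `d` is injective on the range of `A`. -/
theorem injective_projection_comp {d ν : E} (hd : ‖d‖ = 1) (A : M →L[ℝ] E)
    (hinj : Function.Injective A) (hA : ∀ u, ⟪ν, A u⟫ = 0) (hdν : ⟪d, ν⟫ ≠ 0) :
    Function.Injective (fun u => (ℝ ∙ d)ᗮ.orthogonalProjectionOnto (A u)) := by
  intro x y hxy
  have h : (ℝ ∙ d)ᗮ.orthogonalProjectionOnto (A (x - y)) = 0 := by
    simp only at hxy
    rw [map_sub, map_sub, hxy, sub_self]
  have h' := congrArg (Subtype.val) h
  rw [coe_orthogonalProjectionOnto_orthogonal_span hd] at h'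
  have h2 : A (x - y) = ⟪d, A (x - y)⟫ • d := sub_eq_zero.1 h'
  have h3 := hA (x - y)
  rw [h2, inner_smul_right, real_inner_comm d ν] at h3
  have h4 : ⟪d, A (x - y)⟫ = 0 := by
    rcases mul_eq_zero.1 h3 with h4 | h4
    · exact h4
    · exact absurd h4 hdν
  rw [h4, zero_smul] at h2
  have : x - y = 0 := hinj (by rw [h2, map_zero])
  exact sub_eq_zero.1 this

end Area

/-! ### Area formula for the projection of a hypersurface along `d`. -/

section AreaFormula

open Measure Module
open scoped NNReal ENNReal RealInnerProductSpace

variable {E : Type*} [NormedAddCommGroup E] [InnerProductSpace ℝ E]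
  [FiniteDimensional ℝ E] [MeasurableSpace E] [BorelSpace E]
  {M : Type*} [NormedAddCommGroup M] [InnerProductSpace ℝ M]
  [FiniteDimensional ℝ M] [MeasurableSpace M] [BorelSpace M]

theorem disjoint_image_of_injOn {α β : Type*} {f : α → β} {X s t : Set α} (hf : InjOn f X)
    (hs : s ⊆ X) (ht : t ⊆ X) (h : Disjoint s t) : Disjoint (f '' s) (f '' t) := by
  rw [Set.disjoint_iff_inter_eq_empty, ← hf.image_inter hs ht, h.inter_eq, image_empty]

/-- Localization: `X` is split into countably many pieces on which `f` is nearly linear and the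
Jacobian `θ` varies by at most a factor `lam`. The bounds of the linear case add up over the pieces;
the oscillation of `θ` contributes the extra `1` in the exponent. -/
theorem projection_area_bounds {d : E} (hd : ‖d‖ = 1)
    (hrank : finrank ℝ E = finrank ℝ M + 1) {f : M → E} (hfc : Continuous f)
    {f' : M → M →L[ℝ] E} {X : Set M} (hX : MeasurableSet X)
    (hf : ∀ x ∈ X, HasFDerivAt f (f' x) x) (hinj : ∀ x ∈ X, Function.Injective (f' x))
    (hfinj : InjOn f X) {ν : M → E} (hν : ∀ x ∈ X, ‖ν x‖ = 1)
    (hort : ∀ x ∈ X, ∀ u, ⟪ν x, f' x u⟫ = 0) (hdν : ∀ x ∈ X, ⟪d, ν x⟫ ≠ 0)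
    {θ : E → ℝ} (hθ : Measurable θ) (hθν : ∀ x ∈ X, θ (f x) = |⟪d, ν x⟫|)
    (hPinj : InjOn (fun x => (ℝ ∙ d)ᗮ.orthogonalProjectionOnto (f x)) X)
    {lam : ℝ≥0} (hlam : 1 < lam) :
    (μHE[finrank ℝ M] : Measure (ℝ ∙ d)ᗮ)
        ((fun x => (ℝ ∙ d)ᗮ.orthogonalProjectionOnto (f x)) '' X)
      ≤ (lam : ℝ≥0∞) ^ (2 * finrank ℝ M + 1) *
        ∫⁻ s in f '' X, ENNReal.ofReal (θ s) ∂(μHE[finrank ℝ M]) ∧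
    ∫⁻ s in f '' X, ENNReal.ofReal (θ s) ∂(μHE[finrank ℝ M])
      ≤ (lam : ℝ≥0∞) ^ (2 * finrank ℝ M + 1) *
        (μHE[finrank ℝ M] : Measure (ℝ ∙ d)ᗮ)
        ((fun x => (ℝ ∙ d)ᗮ.orthogonalProjectionOnto (f x)) '' X) := by
  set P := (ℝ ∙ d)ᗮ.orthogonalProjectionOnto with hP
  set m := finrank ℝ M with hm
  have hl : (1 : ℝ) < lam := by exact_mod_cast hlam
  have hl0 : (0 : ℝ) < lam := by linarith
  choose δ hδ0 hδ using exists_tolerance (d := d) (M := M) lam hlam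
  -- Geometric shells of the Jacobian. They exhaust `X` because `θ ∘ f` is positive there.
  set L : ℤ → Set M := fun k => X ∩ (fun x => θ (f x)) ⁻¹' Ico ((lam : ℝ) ^ k) ((lam : ℝ) ^ (k + 1))
    with hL
  have hLm : ∀ k, MeasurableSet (L k) := fun k =>
    hX.inter ((hθ.comp hfc.measurable) measurableSet_Ico)
  have hLX : ∀ k, L k ⊆ X := fun k => inter_subset_left
  have hpart := fun k => exists_partition_approximatesLinearOn_of_hasFDerivWithinAt f (L k) f'
    (fun x hx => (hf x (hLX k hx)).hasFDerivWithinAt) δ hδ0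
  choose t A htd htm htc hta htA using hpart
  set Y : ℤ × ℕ → Set M := fun i => L i.1 ∩ t i.1 i.2 with hY
  have hYm : ∀ i, MeasurableSet (Y i) := fun i => (hLm i.1).inter (htm i.1 i.2)
  have hYX : ∀ i, Y i ⊆ X := fun i => inter_subset_left.trans (hLX i.1)
  have hYd : Pairwise (Function.onFun Disjoint Y) := by
    rintro ⟨k, n⟩ ⟨k', n'⟩ hne
    by_cases hk : k = k'
    · subst hk
      have hn : n ≠ n' := fun h => hne (by rw [h])
      exact (htd k hn).mono inter_subset_right inter_subset_right
    · rw [Function.onFun, Set.disjoint_left]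
      rintro x ⟨⟨_, hx1, hx2⟩, _⟩ ⟨⟨_, hx3, hx4⟩, _⟩
      rcases lt_or_gt_of_ne hk with h | h
      · have := zpow_le_zpow_right₀ hl.le (show k + 1 ≤ k' by omega)
        linarith
      · have := zpow_le_zpow_right₀ hl.le (show k' + 1 ≤ k by omega)
        linarith
  have hYU : X = ⋃ i, Y i := by
    apply Subset.antisymm
    · intro x hx
      have hpos : 0 < θ (f x) := by rw [hθν x hx]; exact abs_pos.2 (hdν x hx)
      obtain ⟨k, hk⟩ := exists_mem_Ico_zpow hpos hl
      have hxL : x ∈ L k := ⟨hx, hk⟩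
      obtain ⟨n, hn⟩ := mem_iUnion.1 (htc k hxL)
      exact mem_iUnion.2 ⟨(k, n), hxL, hn⟩
    · exact iUnion_subset hYX
  have hfm : ∀ i, MeasurableSet (f '' Y i) := fun i =>
    (hYm i).image_of_continuousOn_injOn hfc.continuousOn (hfinj.mono (hYX i))
  have hPc : Continuous fun x => P (f x) := P.continuous.comp hfc
  have hPm : ∀ i, MeasurableSet ((fun x => P (f x)) '' Y i) := fun i =>
    (hYm i).image_of_continuousOn_injOn hPc.continuousOn (hPinj.mono (hYX i))
  have sum1 : ∫⁻ s in f '' X, ENNReal.ofReal (θ s) ∂(μHE[m])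
      = ∑' i, ∫⁻ s in f '' Y i, ENNReal.ofReal (θ s) ∂(μHE[m]) := by
    rw [hYU, image_iUnion, lintegral_iUnion hfm]
    intro i j hij
    exact disjoint_image_of_injOn hfinj (hYX i) (hYX j) (hYd hij)
  have sum2 : (μHE[m] : Measure (ℝ ∙ d)ᗮ) ((fun x => P (f x)) '' X)
      = ∑' i, (μHE[m] : Measure (ℝ ∙ d)ᗮ) ((fun x => P (f x)) '' Y i) := by
    rw [hYU, image_iUnion, measure_iUnion _ hPm]
    intro i j hij
    exact disjoint_image_of_injOn hPinj (hYX i) (hYX j) (hYd hij)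
  have key : ∀ i, (μHE[m] : Measure (ℝ ∙ d)ᗮ) ((fun x => P (f x)) '' Y i)
      ≤ (lam : ℝ≥0∞) ^ (2 * m + 1) * ∫⁻ s in f '' Y i, ENNReal.ofReal (θ s) ∂(μHE[m]) ∧
      ∫⁻ s in f '' Y i, ENNReal.ofReal (θ s) ∂(μHE[m])
      ≤ (lam : ℝ≥0∞) ^ (2 * m + 1) * (μHE[m] : Measure (ℝ ∙ d)ᗮ) ((fun x => P (f x)) '' Y i) := by
    rintro ⟨k, n⟩
    rcases (L k).eq_empty_or_nonempty with h0 | hne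
    · simp [hY, h0]
    -- Each approximating map is the actual derivative at some point of the shell, so it inherits
    -- injectivity, the normal and transversality to `d`. This does not need the point to lie in the
    -- piece itself.
    obtain ⟨y, hy, hAy⟩ := htA k hne n
    have hyX := hLX k hy
    have hinjA : Function.Injective (A k n) := hAy ▸ hinj y hyX
    have hortA : ∀ u, ⟪ν y, A k n u⟫ = 0 := hAy ▸ hort y hyX
    have hPA := injective_projection_comp hd (A k n) hinjA hortA (hdν y hyX)
    have hb := projection_image_bounds_of_approximatesLinearOn hd (hν y hyX) hrank hlam
      (hta k n) hinjA hortA (hδ (A k n) hPA)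
    rw [← hθν y hyX] at hb
    have hyl : θ (f y) ∈ Ico ((lam : ℝ) ^ k) ((lam : ℝ) ^ (k + 1)) := hy.2
    have hz : (lam : ℝ) ^ (k + 1) = lam * (lam : ℝ) ^ k := by
      rw [zpow_add_one₀ hl0.ne', mul_comm]
    have c1 : ENNReal.ofReal (θ (f y)) * μHE[m] (f '' Y (k, n))
        ≤ lam * ∫⁻ s in f '' Y (k, n), ENNReal.ofReal (θ s) ∂(μHE[m]) := by
      rw [← lintegral_const_mul _ hθ.ennreal_ofReal, ← setLIntegral_const]
      refine setLIntegral_mono' (hfm _) ?_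
      rintro _ ⟨x, hx, rfl⟩
      have hxl : θ (f x) ∈ Ico ((lam : ℝ) ^ k) ((lam : ℝ) ^ (k + 1)) := hx.1.2
      rw [← ENNReal.ofReal_coe_nnreal, ← ENNReal.ofReal_mul hl0.le]
      apply ENNReal.ofReal_le_ofReal
      calc θ (f y) ≤ lam * (lam : ℝ) ^ k := hz ▸ hyl.2.le
        _ ≤ lam * θ (f x) := mul_le_mul_of_nonneg_left hxl.1 hl0.le
    have c2 : ∫⁻ s in f '' Y (k, n), ENNReal.ofReal (θ s) ∂(μHE[m])
        ≤ lam * (ENNReal.ofReal (θ (f y)) * μHE[m] (f '' Y (k, n))) := by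
      rw [← mul_assoc, ← setLIntegral_const]
      refine setLIntegral_mono' (hfm _) ?_
      rintro _ ⟨x, hx, rfl⟩
      have hxl : θ (f x) ∈ Ico ((lam : ℝ) ^ k) ((lam : ℝ) ^ (k + 1)) := hx.1.2
      rw [← ENNReal.ofReal_coe_nnreal, ← ENNReal.ofReal_mul hl0.le]
      apply ENNReal.ofReal_le_ofReal
      calc θ (f x) ≤ lam * (lam : ℝ) ^ k := hz ▸ hxl.2.le
        _ ≤ lam * θ (f y) := mul_le_mul_of_nonneg_left hyl.1 hl0.le
    constructor
    · calc _ ≤ _ := hb.1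
        _ ≤ (lam : ℝ≥0∞) ^ (2 * m) * (lam *
            ∫⁻ s in f '' Y (k, n), ENNReal.ofReal (θ s) ∂(μHE[m])) := by gcongr
        _ = _ := by ring
    · calc _ ≤ _ := c2
        _ ≤ lam * ((lam : ℝ≥0∞) ^ (2 * m) *
            (μHE[m] : Measure (ℝ ∙ d)ᗮ) ((fun x => P (f x)) '' Y (k, n))) :=
          mul_le_mul_right hb.2 _
        _ = _ := by ring
  rw [sum1, sum2, ← ENNReal.tsum_mul_left, ← ENNReal.tsum_mul_left]
  exact ⟨ENNReal.tsum_le_tsum fun i => (key i).1, ENNReal.tsum_le_tsum fun i => (key i).2⟩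

theorem le_of_forall_one_lt_pow_mul {a b : ℝ≥0∞} (N : ℕ)
    (h : ∀ lam : ℝ≥0, 1 < lam → a ≤ (lam : ℝ≥0∞) ^ N * b) : a ≤ b := by
  have h1 : Tendsto (fun lam : ℝ≥0 => (lam : ℝ≥0∞) ^ N * b) (𝓝 1) (𝓝 (((1 : ℝ≥0) : ℝ≥0∞) ^ N * b)) := by
    refine ENNReal.Tendsto.mul_const ?_ (Or.inl (by simp))
    exact ((ENNReal.continuous_pow N).comp ENNReal.continuous_coe).tendsto 1
  simp only [ENNReal.coe_one, one_pow, one_mul] at h1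
  refine ge_of_tendsto (h1.mono_left (nhdsWithin_le_nhds (s := Ioi 1))) ?_
  filter_upwards [self_mem_nhdsWithin] with lam hlam using h lam hlam

/-- Area formula for the orthogonal projection of a parametrized hypersurface with unit normal `ν`
to the hyperplane orthogonal to `d`. -/
theorem projection_area_formula {d : E} (hd : ‖d‖ = 1)
    (hrank : finrank ℝ E = finrank ℝ M + 1) {f : M → E} (hfc : Continuous f)
    {f' : M → M →L[ℝ] E} {X : Set M} (hX : MeasurableSet X)
    (hf : ∀ x ∈ X, HasFDerivAt f (f' x) x) (hinj : ∀ x ∈ X, Function.Injective (f' x))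
    (hfinj : InjOn f X) {ν : M → E} (hν : ∀ x ∈ X, ‖ν x‖ = 1)
    (hort : ∀ x ∈ X, ∀ u, ⟪ν x, f' x u⟫ = 0) (hdν : ∀ x ∈ X, ⟪d, ν x⟫ ≠ 0)
    {θ : E → ℝ} (hθ : Measurable θ) (hθν : ∀ x ∈ X, θ (f x) = |⟪d, ν x⟫|)
    (hPinj : InjOn (fun x => (ℝ ∙ d)ᗮ.orthogonalProjectionOnto (f x)) X) :
    (μHE[finrank ℝ M] : Measure (ℝ ∙ d)ᗮ)
        ((fun x => (ℝ ∙ d)ᗮ.orthogonalProjectionOnto (f x)) '' X)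
      = ∫⁻ s in f '' X, ENNReal.ofReal (θ s) ∂(μHE[finrank ℝ M]) :=
  le_antisymm
    (le_of_forall_one_lt_pow_mul _ fun _ hlam => (projection_area_bounds hd hrank hfc hX hf hinj
      hfinj hν hort hdν hθ hθν hPinj hlam).1)
    (le_of_forall_one_lt_pow_mul _ fun _ hlam => (projection_area_bounds hd hrank hfc hX hf hinj
      hfinj hν hort hdν hθ hθν hPinj hlam).2)

end AreaFormula

/-! ### Lipschitz graphs: parametrization, normals and exceptional sets. -/

noncomputable section Graph

open Measure Module
open scoped NNReal ENNReal RealInnerProductSpace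

variable {E : Type*} [NormedAddCommGroup E] [InnerProductSpace ℝ E]
  [FiniteDimensional ℝ E]

/-- The parametrization `x ↦ x + ψ x • e` of the graph of `ψ` over the hyperplane `eᗮ`. -/
def graphMap (e : E) (ψ : (ℝ ∙ e)ᗮ → ℝ) (x : (ℝ ∙ e)ᗮ) : E := x + ψ x • e

/-- The derivative of `graphMap e ψ`. -/
def graphDeriv (e : E) (ψ : (ℝ ∙ e)ᗮ → ℝ) (x : (ℝ ∙ e)ᗮ) : (ℝ ∙ e)ᗮ →L[ℝ] E :=
  (ℝ ∙ e)ᗮ.subtypeL + (fderiv ℝ ψ x).smulRight e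

/-- The downward normal `∇ψ - e` to the graph of `ψ`. -/
def graphNormal (e : E) (ψ : (ℝ ∙ e)ᗮ → ℝ) (x : (ℝ ∙ e)ᗮ) : E := ((gradient ψ x : (ℝ ∙ e)ᗮ) : E) - e

/-- The downward unit normal to the graph of `ψ`. -/
def graphUnitNormal (e : E) (ψ : (ℝ ∙ e)ᗮ → ℝ) (x : (ℝ ∙ e)ᗮ) : E :=
  ‖graphNormal e ψ x‖⁻¹ • graphNormal e ψ x

variable {e : E} {ψ : (ℝ ∙ e)ᗮ → ℝ}

theorem inner_coe_orthogonal (y : (ℝ ∙ e)ᗮ) : ⟪e, (y : E)⟫ = 0 :=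
  Submodule.mem_orthogonal_singleton_iff_inner_right.1 y.2

theorem projection_graphMap (x : (ℝ ∙ e)ᗮ) :
    (ℝ ∙ e)ᗮ.orthogonalProjectionOnto (graphMap e ψ x) = x := by
  have : (ℝ ∙ e)ᗮ.orthogonalProjectionOnto e = 0 :=
    Submodule.orthogonalProjectionOnto_orthogonal_apply_eq_zero
      (Submodule.mem_span_singleton_self e)
  rw [graphMap, map_add, map_smul, this, smul_zero, add_zero,
    Submodule.orthogonalProjectionOnto_mem_subspace_eq_self]

theorem graphMap_injective : Function.Injective (graphMap e ψ) :=
  Function.LeftInverse.injective projection_graphMap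

theorem inner_graphMap (he : ‖e‖ = 1) (x : (ℝ ∙ e)ᗮ) : ⟪e, graphMap e ψ x⟫ = ψ x := by
  simp [graphMap, inner_add_right, inner_coe_orthogonal, inner_smul_right, he]

theorem graphMap_projection (he : ‖e‖ = 1) {y : E}
    (hy : ψ ((ℝ ∙ e)ᗮ.orthogonalProjectionOnto y) = ⟪e, y⟫) :
    graphMap e ψ ((ℝ ∙ e)ᗮ.orthogonalProjectionOnto y) = y := by
  rw [graphMap, hy, coe_orthogonalProjectionOnto_orthogonal_span he]
  abel

theorem continuous_graphMap (hψ : Continuous ψ) : Continuous (graphMap e ψ) := by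
  unfold graphMap
  fun_prop

theorem graphDeriv_apply (x u : (ℝ ∙ e)ᗮ) :
    graphDeriv e ψ x u = u + (fderiv ℝ ψ x u) • e := by
  simp [graphDeriv]

theorem hasFDerivAt_graphMap {x : (ℝ ∙ e)ᗮ} (hx : DifferentiableAt ℝ ψ x) :
    HasFDerivAt (graphMap e ψ) (graphDeriv e ψ x) x :=
  (ℝ ∙ e)ᗮ.subtypeL.hasFDerivAt.add (hx.hasFDerivAt.smul_const e)

theorem graphDeriv_injective (x : (ℝ ∙ e)ᗮ) : Function.Injective (graphDeriv e ψ x) := by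
  apply Function.LeftInverse.injective (g := (ℝ ∙ e)ᗮ.orthogonalProjectionOnto)
  intro u
  have : (ℝ ∙ e)ᗮ.orthogonalProjectionOnto e = 0 :=
    Submodule.orthogonalProjectionOnto_orthogonal_apply_eq_zero
      (Submodule.mem_span_singleton_self e)
  rw [graphDeriv_apply, map_add, map_smul, this, smul_zero, add_zero,
    Submodule.orthogonalProjectionOnto_mem_subspace_eq_self]

theorem graphNormal_ne_zero (he : ‖e‖ = 1) (x : (ℝ ∙ e)ᗮ) : graphNormal e ψ x ≠ 0 := by
  intro h
  have h1 : ⟪e, graphNormal e ψ x⟫ = -1 := by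
    simp [graphNormal, inner_sub_right, inner_coe_orthogonal, he]
  rw [h, inner_zero_right] at h1
  norm_num at h1

theorem norm_graphUnitNormal (he : ‖e‖ = 1) (x : (ℝ ∙ e)ᗮ) : ‖graphUnitNormal e ψ x‖ = 1 := by
  rw [graphUnitNormal, norm_smul, norm_inv, norm_norm,
    inv_mul_cancel₀ (norm_ne_zero_iff.2 (graphNormal_ne_zero he x))]

theorem inner_graphNormal (y : E) (x : (ℝ ∙ e)ᗮ) :
    ⟪graphNormal e ψ x, y⟫
      = fderiv ℝ ψ x ((ℝ ∙ e)ᗮ.orthogonalProjectionOnto y) - ⟪e, y⟫ := by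
  rw [graphNormal, inner_sub_left, ← inner_gradient_left, Submodule.coe_inner]
  rw [← Submodule.coe_inner, Submodule.inner_orthogonalProjectionOnto_eq_of_mem_left]

theorem inner_graphUnitNormal_graphDeriv (he : ‖e‖ = 1) (x u : (ℝ ∙ e)ᗮ) :
    ⟪graphUnitNormal e ψ x, graphDeriv e ψ x u⟫ = 0 := by
  have : (ℝ ∙ e)ᗮ.orthogonalProjectionOnto e = 0 :=
    Submodule.orthogonalProjectionOnto_orthogonal_apply_eq_zero
      (Submodule.mem_span_singleton_self e)
  rw [graphUnitNormal, inner_smul_left, inner_graphNormal, graphDeriv_apply, map_add, map_smul,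
    this, smul_zero, add_zero, Submodule.orthogonalProjectionOnto_mem_subspace_eq_self,
    inner_add_right, inner_coe_orthogonal, inner_smul_right, real_inner_self_eq_norm_sq, he]
  simp

/-- `K` coincides on the open set `U` with the set of points above the graph of `ψ`. -/
structure IsGraphChart (K : Set E) (e : E) (ψ : (ℝ ∙ e)ᗮ → ℝ) (U : Set E) : Prop where
  norm_eq_one : ‖e‖ = 1
  lipschitz : ∃ L : ℝ≥0, LipschitzWith L ψ
  isOpen : IsOpen U
  mem_iff : ∀ y ∈ U, (y ∈ K ↔ ψ ((ℝ ∙ e)ᗮ.orthogonalProjectionOnto y) < ⟪e, y⟫)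

namespace IsGraphChart

variable {K U : Set E}

theorem continuous (h : IsGraphChart K e ψ U) : Continuous ψ := h.lipschitz.choose_spec.continuous

/-- A boundary point is not in the open set `K`, hence not above the graph; strictly below the graph
it would have a neighbourhood disjoint from `K`. -/
theorem eq_of_mem_frontier (h : IsGraphChart K e ψ U) (hK : IsOpen K) {s : E}
    (hs : s ∈ frontier K) (hsU : s ∈ U) :
    graphMap e ψ ((ℝ ∙ e)ᗮ.orthogonalProjectionOnto s) = s := by
  apply graphMap_projection h.norm_eq_one
  have hsK : s ∉ K := by rw [hK.frontier_eq] at hs; exact hs.2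
  have h1 := (not_congr (h.mem_iff s hsU)).1 hsK
  refine le_antisymm ?_ (not_lt.1 h1)
  by_contra h2
  have h2 : ⟪e, s⟫ < ψ ((ℝ ∙ e)ᗮ.orthogonalProjectionOnto s) := not_le.1 h2
  have hcont : Continuous fun y : E => ψ ((ℝ ∙ e)ᗮ.orthogonalProjectionOnto y) :=
    h.continuous.comp (ContinuousLinearMap.continuous _)
  have hcont' : Continuous fun y : E => ⟪e, y⟫ := by fun_prop
  have hev : ∀ᶠ y in 𝓝 s, y ∉ K := by
    filter_upwards [(isOpen_lt hcont' hcont).mem_nhds h2, h.isOpen.mem_nhds hsU] with y hy hyU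
    rw [h.mem_iff y hyU]
    exact not_lt.2 (le_of_lt hy)
  have := mem_closure_iff_frequently.1 (frontier_subset_closure hs)
  exact this hev

theorem isOuterNormal (h : IsGraphChart K e ψ U) {x : (ℝ ∙ e)ᗮ} (hx : DifferentiableAt ℝ ψ x)
    (hxU : graphMap e ψ x ∈ U) : IsOuterNormal K (graphMap e ψ x) (graphUnitNormal e ψ x) := by
  refine ⟨norm_graphUnitNormal h.norm_eq_one x, fun ε hε => ?_⟩
  set s := graphMap e ψ x with hs
  set N := graphNormal e ψ x with hN
  have hNpos : 0 < ‖N‖ := norm_pos_iff.2 (graphNormal_ne_zero h.norm_eq_one x)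
  have hps : (ℝ ∙ e)ᗮ.orthogonalProjectionOnto s = x := projection_graphMap x
  have hd : HasFDerivAt (fun y : E => ψ ((ℝ ∙ e)ᗮ.orthogonalProjectionOnto y))
      ((fderiv ℝ ψ x) ∘L (ℝ ∙ e)ᗮ.orthogonalProjectionOnto) s := by
    refine HasFDerivAt.comp s ?_ (ContinuousLinearMap.hasFDerivAt _)
    rw [hps]
    exact hx.hasFDerivAt
  -- The factor `‖N‖` compensates for the normalization: the first-order expansion involves `N`, the
  -- definition of the outer normal involves `N / ‖N‖`.
  have hlittle := hd.isLittleO.def (mul_pos hε hNpos)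
  filter_upwards [hlittle, h.isOpen.mem_nhds hxU] with y hy hyU
  have hinner : ⟪y - s, graphUnitNormal e ψ x⟫ = ‖N‖⁻¹ * ⟪N, y - s⟫ := by
    rw [real_inner_comm, graphUnitNormal, inner_smul_left]; rfl
  have hNi := inner_graphNormal (ψ := ψ) (y - s) x
  rw [← hN] at hNi
  have hes : ⟪e, s⟫ = ψ x := inner_graphMap h.norm_eq_one x
  rw [inner_sub_right e, hes] at hNi
  simp only [hps, ContinuousLinearMap.comp_apply, Real.norm_eq_abs] at hy
  have hy' := abs_le.1 hy
  rw [h.mem_iff y hyU, hinner]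
  constructor
  · intro h1
    have h2 : ⟪N, y - s⟫ < -(ε * ‖N‖ * ‖y - s‖) := by
      have := mul_lt_mul_of_pos_left h1 hNpos
      rw [← mul_assoc, mul_inv_cancel₀ hNpos.ne', one_mul] at this
      linarith
    linarith [hy'.2]
  · intro h1
    have h2 : ε * ‖N‖ * ‖y - s‖ < ⟪N, y - s⟫ := by
      have := mul_lt_mul_of_pos_left h1 hNpos
      rw [← mul_assoc ‖N‖ ‖N‖⁻¹, mul_inv_cancel₀ hNpos.ne', one_mul] at this
      linarith
    linarith [hy'.1]

theorem outerNormal_eq (h : IsGraphChart K e ψ U) {x : (ℝ ∙ e)ᗮ} (hx : DifferentiableAt ℝ ψ x)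
    (hxU : graphMap e ψ x ∈ U) : outerNormal K (graphMap e ψ x) = graphUnitNormal e ψ x :=
  (h.isOuterNormal hx hxU).outerNormal_eq

end IsGraphChart

variable [MeasurableSpace E] [BorelSpace E]

theorem measurable_graphUnitNormal : Measurable (graphUnitNormal e ψ) := by
  have h1 : Measurable (graphNormal e ψ) := by
    unfold graphNormal gradient
    have h2 : Measurable fun x => (InnerProductSpace.toDual ℝ (ℝ ∙ e)ᗮ).symm (fderiv ℝ ψ x) :=
      (InnerProductSpace.toDual ℝ (ℝ ∙ e)ᗮ).symm.continuous.measurable.comp (measurable_fderiv ℝ ψ)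
    exact (measurable_subtype_coe.comp h2).sub_const e
  unfold graphUnitNormal
  exact h1.norm.inv.smul h1

theorem finrank_orthogonal_unit {m : ℕ} (hrank : finrank ℝ E = m + 1) (he : ‖e‖ = 1) :
    finrank ℝ (ℝ ∙ e)ᗮ = m := by
  have : Fact (finrank ℝ E = m + 1) := ⟨hrank⟩
  exact Submodule.finrank_orthogonal_span_singleton (n := m) (by rintro rfl; simp at he)

/-- Rademacher's theorem in the parameter hyperplane, transported by `graphMap`, which is Lipschitz
with constant `1 + L`. -/
theorem measure_graphMap_image_not_differentiable {m : ℕ} (hrank : finrank ℝ E = m + 1)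
    (he : ‖e‖ = 1) {L : ℝ≥0} (hψ : LipschitzWith L ψ) :
    (μHE[m] : Measure E) (graphMap e ψ '' {x | ¬ DifferentiableAt ℝ ψ x}) = 0 := by
  have hm := finrank_orthogonal_unit hrank he
  have h0 : (μHE[m] : Measure (ℝ ∙ e)ᗮ) {x | ¬ DifferentiableAt ℝ ψ x} = 0 := by
    rw [← hm, InnerProductSpace.euclideanHausdorffMeasure_eq_volume]
    exact hψ.ae_differentiableAt
  have := euclideanHausdorffMeasure_image_le_of_dist_le m {x | ¬ DifferentiableAt ℝ ψ x}
    (graphMap e ψ) id (1 + L) (fun x _ y _ => by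
      rw [graphMap, graphMap, dist_eq_norm, id, id]
      have h1 : (x : E) + ψ x • e - (y + ψ y • e) = ((x - y : (ℝ ∙ e)ᗮ) : E) + (ψ x - ψ y) • e := by
        push_cast
        module
      rw [h1]
      refine (norm_add_le _ _).trans ?_
      rw [norm_smul, he, mul_one, ← Submodule.coe_norm, ← dist_eq_norm, ← dist_eq_norm]
      have := hψ.dist_le_mul x y
      push_cast
      linarith)
  rw [image_id, h0, mul_zero] at this
  exact le_antisymm this zero_le

theorem measure_projection_image_le {m : ℕ} (d : E) (s : Set E) :
    (μHE[m] : Measure (ℝ ∙ d)ᗮ) ((ℝ ∙ d)ᗮ.orthogonalProjectionOnto '' s)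
      ≤ (μHE[m] : Measure E) s := by
  have := euclideanHausdorffMeasure_image_le_of_dist_le m s
    (ℝ ∙ d)ᗮ.orthogonalProjectionOnto id 1 (fun x _ y _ => by
      simpa using (ℝ ∙ d)ᗮ.lipschitzWith_orthogonalProjectionOnto.dist_le_mul x y)
  simpa using this

/-- The part of a graph where the tangent plane contains `d` projects along `d` to a null set. -/
theorem measure_projection_image_tangential {m : ℕ} (hrank : finrank ℝ E = m + 1)
    (he : ‖e‖ = 1) {d : E} (hd : ‖d‖ = 1) :
    (μHE[m] : Measure (ℝ ∙ d)ᗮ) ((ℝ ∙ d)ᗮ.orthogonalProjectionOnto ''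
      (graphMap e ψ '' {x | DifferentiableAt ℝ ψ x ∧ ⟪d, graphUnitNormal e ψ x⟫ = 0})) = 0 := by
  have hm := finrank_orthogonal_unit hrank he
  have hmd := finrank_orthogonal_unit hrank hd
  -- The Sard-type lemma concerns maps of a space into itself, so the two hyperplanes are identified
  -- by an isometry, which preserves the measure.
  let ι : (ℝ ∙ d)ᗮ ≃ₗᵢ[ℝ] (ℝ ∙ e)ᗮ :=
    (stdOrthonormalBasis ℝ (ℝ ∙ d)ᗮ).equiv (stdOrthonormalBasis ℝ (ℝ ∙ e)ᗮ)
      (finCongr (hmd.trans hm.symm))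
  set P := (ℝ ∙ d)ᗮ.orthogonalProjectionOnto
  set X := {x | DifferentiableAt ℝ ψ x ∧ ⟪d, graphUnitNormal e ψ x⟫ = 0}
  have hsard : (volume : Measure (ℝ ∙ e)ᗮ) ((fun x => ι (P (graphMap e ψ x))) '' X) = 0 := by
    apply addHaar_image_eq_zero_of_det_fderivWithin_eq_zero (f' := fun x =>
      (ι.toContinuousLinearEquiv : (ℝ ∙ d)ᗮ →L[ℝ] (ℝ ∙ e)ᗮ) ∘L P ∘L graphDeriv e ψ x)
    · intro x hx
      have h1 := hasFDerivAt_graphMap hx.1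
      exact ((((ι.toContinuousLinearEquiv : (ℝ ∙ d)ᗮ →L[ℝ] (ℝ ∙ e)ᗮ) ∘L P).hasFDerivAt
        (x := graphMap e ψ x)).comp x h1).hasFDerivWithinAt
    · intro x hx
      refine LinearMap.det_eq_zero_iff_ker_ne_bot.2 fun hker => ?_
      -- Tangency means that `graphDeriv` sends `u` to `d`, and the projection along `d` kills `d`.
      -- So `u` lies in the kernel, and `u = 0` would force `d = 0`.
      set u : (ℝ ∙ e)ᗮ := (ℝ ∙ e)ᗮ.orthogonalProjectionOnto d with hu
      have hN : ⟪graphNormal e ψ x, d⟫ = 0 := by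
        have h1 := hx.2
        rw [graphUnitNormal, inner_smul_right, real_inner_comm] at h1
        exact (mul_eq_zero.1 h1).resolve_left
          (inv_ne_zero (norm_ne_zero_iff.2 (graphNormal_ne_zero he x)))
      rw [inner_graphNormal, ← hu] at hN
      have hud : graphDeriv e ψ x u = d := by
        rw [graphDeriv_apply, sub_eq_zero.1 hN, hu,
          coe_orthogonalProjectionOnto_orthogonal_span he]
        abel
      have hPd : P d = 0 := Submodule.orthogonalProjectionOnto_orthogonal_apply_eq_zero
        (Submodule.mem_span_singleton_self d)
      have hmem : u ∈ LinearMap.ker (((ι.toContinuousLinearEquiv : (ℝ ∙ d)ᗮ →L[ℝ] (ℝ ∙ e)ᗮ)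
          ∘L P ∘L graphDeriv e ψ x : (ℝ ∙ e)ᗮ →L[ℝ] (ℝ ∙ e)ᗮ) : (ℝ ∙ e)ᗮ →ₗ[ℝ] (ℝ ∙ e)ᗮ) := by
        rw [LinearMap.mem_ker]
        simp [hud, hPd]
      rw [hker, Submodule.mem_bot] at hmem
      rw [hmem, map_zero] at hud
      rw [← hud] at hd
      simp at hd
  have himg : P '' (graphMap e ψ '' X) = ι.symm '' ((fun x => ι (P (graphMap e ψ x))) '' X) := by
    rw [image_image, image_image]
    simp
  rw [himg, ι.symm.isometry.euclideanHausdorffMeasure_image, ← hm,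
    InnerProductSpace.euclideanHausdorffMeasure_eq_volume, hsard]

end Graph

/-! ### Inflow boundary: finitely many charts and a null set of bad lines. -/

noncomputable section Boundary

open Measure Module
open scoped NNReal ENNReal RealInnerProductSpace

variable {E : Type*} [NormedAddCommGroup E] [InnerProductSpace ℝ E]

/-- A measurable piece of the inflow boundary for the direction `d` on which the surface measure is
related to the measure of the projection along `d`. -/
structure IsInflowPiece [MeasurableSpace E] [BorelSpace E] (m : ℕ) (d : E) (K A : Set E) :
    Prop where
  subset : A ⊆ inflow d K
  measurableSet : MeasurableSet A
  exists_density : ∃ θ : E → ℝ, Measurable θ ∧ ∀ s ∈ A, θ s = |⟪d, outerNormal K s⟫|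
  measure_projection : ∀ B ⊆ A, MeasurableSet B →
    InjOn (ℝ ∙ d)ᗮ.orthogonalProjectionOnto B →
    (μHE[m] : Measure (ℝ ∙ d)ᗮ) ((ℝ ∙ d)ᗮ.orthogonalProjectionOnto '' B)
      = ∫⁻ s in B, ENNReal.ofReal |⟪d, outerNormal K s⟫| ∂(μHE[m])

theorem IsInflowPiece.mono [MeasurableSpace E] [BorelSpace E] {m : ℕ} {d : E} {K A B : Set E}
    (h : IsInflowPiece m d K A) (hBA : B ⊆ A) (hB : MeasurableSet B) : IsInflowPiece m d K B where
  subset := hBA.trans h.subset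
  measurableSet := hB
  exists_density := h.exists_density.imp fun _ hθ => ⟨hθ.1, fun s hs => hθ.2 s (hBA hs)⟩
  measure_projection := fun C hC => h.measure_projection C (hC.trans hBA)

variable [FiniteDimensional ℝ E] [MeasurableSpace E] [BorelSpace E]

/-- The parameters of the inflow points of a graph chart at which the graph is differentiable. -/
def chartInflow (d : E) (K : Set E) (e : E) (ψ : (ℝ ∙ e)ᗮ → ℝ) (U : Set E) : Set (ℝ ∙ e)ᗮ :=
  {x | (DifferentiableAt ℝ ψ x ∧ ⟪d, graphUnitNormal e ψ x⟫ < 0) ∧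
    graphMap e ψ x ∈ U ∩ frontier K}

variable {d e : E} {ψ : (ℝ ∙ e)ᗮ → ℝ} {K U : Set E}

/-- On differentiable graph points `outerNormal` is the graph normal, which depends measurably on
the point; this supplies the density, although `outerNormal` itself is defined by choice. The
measure identity is the area formula applied to the preimage of `B` under the parametrization. -/
theorem IsGraphChart.isInflowPiece {m : ℕ} (hrank : finrank ℝ E = m + 1) (hd : ‖d‖ = 1)
    (h : IsGraphChart K e ψ U) :
    IsInflowPiece m d K (graphMap e ψ '' chartInflow d K e ψ U) := by
  have hm := finrank_orthogonal_unit hrank h.norm_eq_one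
  have hc : Continuous (graphMap e ψ) := continuous_graphMap h.continuous
  have hXm : MeasurableSet (chartInflow d K e ψ U) := by
    refine MeasurableSet.inter (MeasurableSet.inter (measurableSet_of_differentiableAt ℝ ψ) ?_)
      (hc.measurable (h.isOpen.measurableSet.inter isClosed_frontier.measurableSet))
    exact measurableSet_lt ((innerSL ℝ d).continuous.measurable.comp
      measurable_graphUnitNormal) measurable_const
  have hN : ∀ x ∈ chartInflow d K e ψ U, outerNormal K (graphMap e ψ x) = graphUnitNormal e ψ x :=
    fun x hx => h.outerNormal_eq hx.1.1 hx.2.1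
  set θ : E → ℝ := fun s => |⟪d, graphUnitNormal e ψ ((ℝ ∙ e)ᗮ.orthogonalProjectionOnto s)⟫|
    with hθ
  have hθm : Measurable θ := by
    have h1 : Measurable fun s : E =>
        ⟪d, graphUnitNormal e ψ ((ℝ ∙ e)ᗮ.orthogonalProjectionOnto s)⟫ :=
      (innerSL ℝ d).continuous.measurable.comp
        (measurable_graphUnitNormal.comp (ContinuousLinearMap.measurable _))
    exact continuous_abs.measurable.comp h1
  have hθg : ∀ x, θ (graphMap e ψ x) = |⟪d, graphUnitNormal e ψ x⟫| := fun x => by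
    simp only [hθ, projection_graphMap]
  have hθN : ∀ s ∈ graphMap e ψ '' chartInflow d K e ψ U, θ s = |⟪d, outerNormal K s⟫| := by
    rintro _ ⟨x, hx, rfl⟩
    rw [hθg, hN x hx]
  refine ⟨?_, ?_, ⟨θ, hθm, hθN⟩, ?_⟩
  · rintro _ ⟨x, hx, rfl⟩
    exact ⟨hx.2.2, by rw [hN x hx]; exact hx.1.2⟩
  · exact hXm.image_of_continuousOn_injOn hc.continuousOn graphMap_injective.injOn
  · intro B hB hBm hinj
    set X := graphMap e ψ ⁻¹' B with hX
    have hXsub : X ⊆ chartInflow d K e ψ U := by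
      intro x hx
      obtain ⟨y, hy, hxy⟩ := hB hx
      rwa [← graphMap_injective hxy]
    have hBX : graphMap e ψ '' X = B := by
      apply image_preimage_eq_of_subset
      exact hB.trans (image_subset_range _ _)
    have key := projection_area_formula hd (hm.symm ▸ hrank) hc (X := X)
      (hc.measurable hBm) (fun x hx => hasFDerivAt_graphMap (hXsub hx).1.1)
      (fun x _ => graphDeriv_injective x) graphMap_injective.injOn
      (fun x _ => norm_graphUnitNormal h.norm_eq_one x)
      (fun x _ u => inner_graphUnitNormal_graphDeriv h.norm_eq_one x u)
      (fun x hx => (hXsub hx).1.2.ne) hθm (fun x _ => hθg x)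
      (fun x hx y hy hxy => graphMap_injective (hinj hx hy hxy))
    rw [hm, hBX] at key
    have hcongr : ∫⁻ s in B, ENNReal.ofReal |⟪d, outerNormal K s⟫| ∂(μHE[m])
        = ∫⁻ s in B, ENNReal.ofReal (θ s) ∂(μHE[m]) :=
      setLIntegral_congr_fun hBm fun s hs => by simp only [hθN s (hB hs)]
    rw [hcongr, ← key, ← hBX, image_image]

/-- `Z` collects the lines through non-differentiable points and through tangential points. Only the
projection of the latter is null: tangential points may have positive surface measure. -/
theorem IsGraphChart.exists_projection_null {m : ℕ} (hrank : finrank ℝ E = m + 1) (hd : ‖d‖ = 1)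
    (hK : IsOpen K) (h : IsGraphChart K e ψ U) :
    ∃ Z : Set (ℝ ∙ d)ᗮ, (μHE[m] : Measure (ℝ ∙ d)ᗮ) Z = 0 ∧ ∀ s ∈ frontier K ∩ U,
      (ℝ ∙ d)ᗮ.orthogonalProjectionOnto s ∉ Z → ∃ ν, IsOuterNormal K s ν ∧ ⟪d, ν⟫ ≠ 0 := by
  obtain ⟨L, hL⟩ := h.lipschitz
  refine ⟨(ℝ ∙ d)ᗮ.orthogonalProjectionOnto '' (graphMap e ψ '' {x | ¬ DifferentiableAt ℝ ψ x}) ∪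
    (ℝ ∙ d)ᗮ.orthogonalProjectionOnto '' (graphMap e ψ ''
      {x | DifferentiableAt ℝ ψ x ∧ ⟪d, graphUnitNormal e ψ x⟫ = 0}), ?_, ?_⟩
  · refine measure_union_null ?_ (measure_projection_image_tangential hrank h.norm_eq_one hd)
    refine le_antisymm ((measure_projection_image_le d _).trans ?_) zero_le
    rw [measure_graphMap_image_not_differentiable hrank h.norm_eq_one hL]
  · rintro s ⟨hsf, hsU⟩ hsZ
    have hgs := h.eq_of_mem_frontier hK hsf hsU
    set x := (ℝ ∙ e)ᗮ.orthogonalProjectionOnto s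
    have hdiff : DifferentiableAt ℝ ψ x := by
      by_contra hnd
      exact hsZ (Or.inl ⟨s, ⟨x, hnd, hgs⟩, rfl⟩)
    refine ⟨graphUnitNormal e ψ x, ?_, fun h0 => hsZ (Or.inr ⟨s, ⟨x, ⟨hdiff, h0⟩, hgs⟩, rfl⟩)⟩
    have := h.isOuterNormal hdiff (by rw [hgs]; exact hsU)
    rwa [hgs] at this

theorem IsGraphChart.measure_inflow_diff {m : ℕ} (hrank : finrank ℝ E = m + 1)
    (hK : IsOpen K) (h : IsGraphChart K e ψ U) :
    (μHE[m] : Measure E) ((inflow d K ∩ U) \ graphMap e ψ '' chartInflow d K e ψ U) = 0 := by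
  obtain ⟨L, hL⟩ := h.lipschitz
  refine measure_mono_null ?_ (measure_graphMap_image_not_differentiable hrank h.norm_eq_one hL)
  rintro s ⟨⟨⟨hsf, hsd⟩, hsU⟩, hs⟩
  have hgs := h.eq_of_mem_frontier hK hsf hsU
  refine ⟨_, fun hdiff => hs ?_, hgs⟩
  refine ⟨_, ⟨⟨hdiff, ?_⟩, ?_⟩, hgs⟩
  · rwa [← h.outerNormal_eq hdiff (by rw [hgs]; exact hsU), hgs]
  · rw [hgs]; exact ⟨hsU, hsf⟩

theorem IsLipschitzDomain.exists_isGraphChart (hK : IsLipschitzDomain K) {x : E}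
    (hx : x ∈ frontier K) : ∃ (e : E) (ψ : (ℝ ∙ e)ᗮ → ℝ) (U : Set E),
      IsGraphChart K e ψ U ∧ x ∈ U := by
  obtain ⟨e, he, L, ψ, hψ, U, hU, hUK⟩ := hK.exists_graph x hx
  exact ⟨e, ψ, interior U, ⟨he, ⟨L, hψ⟩, isOpen_interior, fun y hy => hUK y (interior_subset hy)⟩,
    mem_interior_iff_mem_nhds.2 hU⟩

/-- The boundary is compact, so finitely many charts suffice, and the exceptional sets of the charts
can be united. -/
theorem IsLipschitzDomain.exists_inflow_cover {m : ℕ} (hrank : finrank ℝ E = m + 1)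
    (hd : ‖d‖ = 1) (hK : IsLipschitzDomain K) :
    ∃ (t : Finset E) (S : E → Set E), (∀ x ∈ t, IsInflowPiece m d K (S x)) ∧
      (μHE[m] : Measure E) (inflow d K \ ⋃ x ∈ t, S x) = 0 ∧
      ∃ Z : Set (ℝ ∙ d)ᗮ, (μHE[m] : Measure (ℝ ∙ d)ᗮ) Z = 0 ∧ ∀ s ∈ frontier K,
        (ℝ ∙ d)ᗮ.orthogonalProjectionOnto s ∉ Z → ∃ ν, IsOuterNormal K s ν ∧ ⟪d, ν⟫ ≠ 0 := by
  have hchart := fun (x : E) (hx : x ∈ frontier K) => hK.exists_isGraphChart hx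
  -- Since the type of `ψ` depends on `e`, the choice is made total first, with dummy data away from
  -- the boundary.
  choose! e ψ' U hchart using fun (x : E) => (show ∃ (e : E) (ψ : (ℝ ∙ e)ᗮ → ℝ) (U : Set E),
      x ∈ frontier K → IsGraphChart K e ψ U ∧ x ∈ U by
    by_cases hx : x ∈ frontier K
    · obtain ⟨e, ψ, U, h⟩ := hchart x hx
      exact ⟨e, ψ, U, fun _ => h⟩
    · exact ⟨0, 0, ∅, fun h => absurd h hx⟩)
  have hcomp : IsCompact (frontier K) := Metric.isCompact_of_isClosed_isBounded isClosed_frontier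
    (hK.isBounded.closure.subset frontier_subset_closure)
  obtain ⟨t, htf, htc⟩ := hcomp.elim_nhds_subcover U
    fun x hx => (hchart x hx).1.isOpen.mem_nhds (hchart x hx).2
  have hZ := fun (x : E) (hx : x ∈ frontier K) =>
    (hchart x hx).1.exists_projection_null hrank hd hK.isOpen
  choose! Z hZ0 hZ using hZ
  refine ⟨t, fun x => graphMap (e x) (ψ' x) '' chartInflow d K (e x) (ψ' x) (U x),
    fun x hx => (hchart x (htf x hx)).1.isInflowPiece hrank hd, ?_, ⋃ x ∈ t, Z x, ?_, ?_⟩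
  · have h0 : (μHE[m] : Measure E) (⋃ x ∈ t, ((inflow d K ∩ U x) \
        graphMap (e x) (ψ' x) '' chartInflow d K (e x) (ψ' x) (U x))) = 0 :=
      (measure_biUnion_null_iff t.countable_toSet).2
        fun x hx => (hchart x (htf x hx)).1.measure_inflow_diff hrank hK.isOpen
    refine measure_mono_null ?_ h0
    rintro s ⟨hs, hsn⟩
    obtain ⟨x, hx, hsx⟩ := mem_iUnion₂.1 (htc hs.1)
    exact mem_iUnion₂.2 ⟨x, hx, ⟨hs, hsx⟩, fun h => hsn (mem_iUnion₂.2 ⟨x, hx, h⟩)⟩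
  · exact (measure_biUnion_null_iff t.countable_toSet).2 fun x hx => hZ0 x (htf x hx)
  · intro s hs hsZ
    obtain ⟨x, hx, hsx⟩ := mem_iUnion₂.1 (htc hs)
    exact hZ x (htf x hx) s ⟨hs, hsx⟩ fun h => hsZ (mem_iUnion₂.2 ⟨x, hx, h⟩)

end Boundary

/-! ### Characteristics: measurability, disjointness, entry and exit. -/

noncomputable section Characteristics

open Measure Module
open scoped NNReal ENNReal RealInnerProductSpace

section Topology

variable {E : Type*} [NormedAddCommGroup E] [NormedSpace ℝ E]

/-- The pairs `(s, t)` with `t > 0` such that the half-open segment `(s, s + t d]` lies in `K`. -/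
def charDomain (d : E) (K : Set E) : Set (E × ℝ) :=
  {p | 0 < p.2 ∧ ∀ τ ∈ Ioc 0 p.2, p.1 + τ • d ∈ K}

/-- A compact segment in an open set stays in it under small perturbations of its data. Rescaling by
`θ` makes the parameter interval independent of the length. -/
theorem isOpen_segment_subset (d : E) {K : Set E} (hK : IsOpen K) (a : ℝ) :
    IsOpen {p : E × ℝ | ∀ θ ∈ Icc a 1, p.1 + (θ * p.2) • d ∈ K} := by
  rw [isOpen_iff_eventually]
  intro p hp
  refine isCompact_Icc.eventually_forall_of_forall_eventually fun θ hθ => ?_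
  have hc : Continuous fun z : (E × ℝ) × ℝ => z.1.1 + (z.2 * z.1.2) • d := by fun_prop
  exact hc.continuousAt.eventually (hK.mem_nhds (hp θ hθ))

theorem measurableSet_charDomain [MeasurableSpace E] [BorelSpace E] [SecondCountableTopology E]
    (d : E) {K : Set E} (hK : IsOpen K) : MeasurableSet (charDomain d K) := by
  -- The segment omits its starting point, which usually lies on the boundary, so openness is lost;
  -- it is an increasing union of closed segments, each giving an open condition.
  have : charDomain d K = {p | 0 < p.2} ∩
      ⋂ m : ℕ, {p : E × ℝ | ∀ θ ∈ Icc (1 / ((m : ℝ) + 1)) 1, p.1 + (θ * p.2) • d ∈ K} := by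
    ext ⟨s, t⟩
    simp only [charDomain, mem_ofPred_eq, mem_inter_iff, mem_iInter]
    refine and_congr_right fun ht => ⟨fun h m θ hθ => h _ ⟨?_, ?_⟩, fun h τ hτ => ?_⟩
    · exact mul_pos (lt_of_lt_of_le (by positivity) hθ.1) ht
    · exact mul_le_of_le_one_left ht.le hθ.2
    · obtain ⟨m, hm⟩ := exists_nat_one_div_lt (div_pos hτ.1 ht)
      have := h m (τ / t) ⟨hm.le, (div_le_one ht).2 hτ.2⟩
      rwa [div_mul_cancel₀ _ ht.ne'] at this
  rw [this]
  exact (measurableSet_lt measurable_const measurable_snd).inter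
    (MeasurableSet.iInter fun m => (isOpen_segment_subset d hK _).measurableSet)

end Topology

variable {E : Type*} [NormedAddCommGroup E] [InnerProductSpace ℝ E]

theorem eq_projection_add {d : E} (hd : ‖d‖ = 1) (s : E) :
    s = ((ℝ ∙ d)ᗮ.orthogonalProjectionOnto s : E) + ⟪d, s⟫ • d := by
  rw [coe_orthogonalProjectionOnto_orthogonal_span hd]; abel

theorem projection_add_smul {d : E} (s : E) (t : ℝ) :
    (ℝ ∙ d)ᗮ.orthogonalProjectionOnto (s + t • d) = (ℝ ∙ d)ᗮ.orthogonalProjectionOnto s := by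
  rw [map_add, map_smul, Submodule.orthogonalProjectionOnto_orthogonal_apply_eq_zero
      (Submodule.mem_span_singleton_self d), smul_zero, add_zero]

theorem inner_add_smul_self {d : E} (hd : ‖d‖ = 1) (s : E) (t : ℝ) :
    ⟪d, s + t • d⟫ = ⟪d, s⟫ + t := by
  simp [inner_add_right, inner_smul_right, hd]

variable {d : E} {K : Set E}

/-- Different entry points on the same line have disjoint characteristics. -/
theorem eq_of_mem_charDomain (hd : ‖d‖ = 1) {s s' : E} (hs : s ∉ K) (hs' : s' ∉ K)
    (hP : (ℝ ∙ d)ᗮ.orthogonalProjectionOnto s = (ℝ ∙ d)ᗮ.orthogonalProjectionOnto s') {q : ℝ}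
    (h : (s, q - ⟪d, s⟫) ∈ charDomain d K) (h' : (s', q - ⟪d, s'⟫) ∈ charDomain d K) :
    s = s' := by
  have aux : ∀ {s s' : E}, s' ∉ K →
      (ℝ ∙ d)ᗮ.orthogonalProjectionOnto s = (ℝ ∙ d)ᗮ.orthogonalProjectionOnto s' →
      (s, q - ⟪d, s⟫) ∈ charDomain d K → (s', q - ⟪d, s'⟫) ∈ charDomain d K →
      ⟪d, s'⟫ ≤ ⟪d, s⟫ := by
    intro s s' hs' hP h h'
    by_contra hlt
    have hlt := not_le.1 hlt
    have hq : 0 < q - ⟪d, s'⟫ := h'.1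
    -- The later starting point `s'` would lie on the characteristic of `s`, hence in `K`.
    have := h.2 (⟪d, s'⟫ - ⟪d, s⟫) ⟨by linarith, by simp only; linarith⟩
    apply hs'
    rw [eq_projection_add hd s', ← hP]
    convert this using 1
    simp only
    nth_rw 2 [eq_projection_add hd s]
    module
  rw [eq_projection_add hd s, eq_projection_add hd s', hP,
    le_antisymm (aux hs hP.symm h' h) (aux hs' hP h h')]

/-- If `⟪d, ν⟫` were positive, the ray from `s` would run inside the exterior cone at `s`, with
opening `ε = ⟪d, ν⟫ / 2`, and so avoid `K` near `s`. -/
theorem IsOuterNormal.inner_nonpos_of_forward {s ν : E} (hν : IsOuterNormal K s ν)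
    {δ : ℝ} (hδ : 0 < δ) (hd : ‖d‖ = 1) (h : ∀ τ ∈ Ioo 0 δ, s + τ • d ∈ K) : ⟪d, ν⟫ ≤ 0 := by
  by_contra hpos
  have hpos := not_le.1 hpos
  have hT : Tendsto (fun t : ℝ => s + t • d) (𝓝[>] 0) (𝓝 s) := by
    have : Tendsto (fun t : ℝ => s + t • d) (𝓝 0) (𝓝 (s + (0 : ℝ) • d)) :=
      Continuous.tendsto (by fun_prop) 0
    rw [zero_smul, add_zero] at this
    exact this.mono_left nhdsWithin_le_nhds
  obtain ⟨t, ht, ht'⟩ := ((hT.eventually (hν.2 (⟪d, ν⟫ / 2) (by linarith))).and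
    (Ioo_mem_nhdsGT hδ)).exists
  refine ht.2 ?_ (h t ht')
  rw [add_sub_cancel_left, norm_smul, hd, inner_smul_left, Real.norm_of_nonneg ht'.1.le]
  simp only [conj_trivial, mul_one]
  nlinarith [ht'.1, mul_pos ht'.1 hpos]

theorem IsOuterNormal.inner_nonneg_of_backward {s ν : E} (hν : IsOuterNormal K s ν)
    {δ : ℝ} (hδ : 0 < δ) (hd : ‖d‖ = 1) (h : ∀ τ ∈ Ioo 0 δ, s + τ • (-d) ∈ K) : 0 ≤ ⟪d, ν⟫ := by
  have := hν.inner_nonpos_of_forward hδ (by rw [norm_neg, hd]) h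
  rw [inner_neg_left] at this
  linarith

theorem exists_isOuterNormal_of_mem_inflow {s : E} (hs : s ∈ inflow d K) :
    ∃ ν, IsOuterNormal K s ν ∧ ⟪d, ν⟫ < 0 := by
  have h := hs.2
  by_cases hex : ∃ ν, IsOuterNormal K s ν
  · obtain ⟨ν, hν⟩ := hex
    exact ⟨ν, hν, by rwa [hν.outerNormal_eq] at h⟩
  · rw [outerNormal, dif_neg hex, inner_zero_right] at h
    exact absurd h (lt_irrefl _)

theorem exists_mem_charDomain_of_mem_inflow (hd : ‖d‖ = 1) {s : E} (hs : s ∈ inflow d K) :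
    ∃ t, (s, t) ∈ charDomain d K := by
  obtain ⟨ν, hν, hneg⟩ := exists_isOuterNormal_of_mem_inflow hs
  have hT : Tendsto (fun t : ℝ => s + t • d) (𝓝[>] 0) (𝓝 s) := by
    have : Tendsto (fun t : ℝ => s + t • d) (𝓝 0) (𝓝 (s + (0 : ℝ) • d)) :=
      Continuous.tendsto (by fun_prop) 0
    rw [zero_smul, add_zero] at this
    exact this.mono_left nhdsWithin_le_nhds
  have hev := hT.eventually (hν.2 (-⟪d, ν⟫ / 2) (by linarith))
  obtain ⟨δ, hδ, hδs⟩ := mem_nhdsGT_iff_exists_Ioo_subset.1 hev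
  have hδ : 0 < δ := hδ
  refine ⟨δ / 2, half_pos hδ, fun τ hτ => ?_⟩
  have hτ2 : τ ≤ δ / 2 := hτ.2
  refine (hδs ⟨hτ.1, by linarith⟩).1 ?_
  rw [add_sub_cancel_left, norm_smul, hd, inner_smul_left, Real.norm_of_nonneg hτ.1.le]
  simp only [conj_trivial, mul_one]
  nlinarith [hτ.1, mul_pos hτ.1 (neg_pos.2 hneg)]

/-- The first exit from a bounded open set along a ray. -/
theorem exists_first_exit (hd : ‖d‖ = 1) (hK : IsOpen K) (hKb : Bornology.IsBounded K) {x : E}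
    {t₀ : ℝ} (ht₀ : 0 < t₀) (hx : ∀ τ ∈ Ioc 0 t₀, x + τ • d ∈ K) :
    ∃ r, t₀ < r ∧ x + r • d ∈ frontier K ∧ ∀ τ ∈ Ioo 0 r, x + τ • d ∈ K := by
  have hc : Continuous fun t : ℝ => x + t • d := by fun_prop
  -- The bound `t₀ ≤ t` keeps the possible boundary point `x` at `t = 0` out of the infimum.
  set B : Set ℝ := {t | t₀ ≤ t ∧ x + t • d ∉ K} with hB
  have hBc : IsClosed B := (isClosed_Ici (a := t₀)).inter (hK.isClosed_compl.preimage hc)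
  have hBne : B.Nonempty := by
    obtain ⟨R, hR⟩ := hKb.subset_closedBall 0
    refine ⟨max t₀ (R + ‖x‖ + 1), le_max_left _ _, fun hmem => ?_⟩
    have h1 := hR hmem
    rw [mem_closedBall_zero_iff] at h1
    have h2 : ‖max t₀ (R + ‖x‖ + 1) • d‖ ≤ ‖x + max t₀ (R + ‖x‖ + 1) • d‖ + ‖x‖ := by
      have := norm_sub_le (x + max t₀ (R + ‖x‖ + 1) • d) x
      rwa [add_sub_cancel_left] at this
    rw [norm_smul, hd, mul_one, Real.norm_of_nonneg (ht₀.le.trans (le_max_left _ _))] at h2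
    linarith [le_max_right t₀ (R + ‖x‖ + 1)]
  have hBb : BddBelow B := ⟨t₀, fun t ht => ht.1⟩
  have hr := hBc.csInf_mem hBne hBb
  set r := sInf B
  have hlt : ∀ τ ∈ Ioo 0 r, x + τ • d ∈ K := by
    intro τ hτ
    by_contra hn
    rcases le_or_gt τ t₀ with h | h
    · exact hn (hx τ ⟨hτ.1, h⟩)
    · exact absurd (csInf_le hBb ⟨h.le, hn⟩) (not_le.2 hτ.2)
  have ht₀r : t₀ < r := lt_of_le_of_ne hr.1 fun h => hr.2 (h ▸ hx t₀ ⟨ht₀, le_rfl⟩)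
  refine ⟨r, ht₀r, ?_, hlt⟩
  rw [hK.frontier_eq]
  refine ⟨?_, hr.2⟩
  have hr0 : 0 < r := ht₀.trans ht₀r
  have : r ∈ closure (Ioo 0 r) := by rw [closure_Ioo hr0.ne]; exact ⟨hr0.le, le_rfl⟩
  exact map_mem_closure (f := fun t : ℝ => x + t • d) hc this hlt

/-- If all boundary points on the line through the inflow point `s` are transversal, then the
characteristic starting at `s` leaves `K` through the outflow boundary. -/
theorem charDomain_iff_of_transversal {b : E} (hb : b ≠ 0) (hK : IsOpen K)
    (hKb : Bornology.IsBounded K) {s : E} (hs : s ∈ inflow (direction b) K)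
    (htr : ∀ z ∈ frontier K, (ℝ ∙ direction b)ᗮ.orthogonalProjectionOnto z =
      (ℝ ∙ direction b)ᗮ.orthogonalProjectionOnto s →
      ∃ ν, IsOuterNormal K z ν ∧ ⟪direction b, ν⟫ ≠ 0) :
    0 < charLength b K s ∧ charLength b K s ≤ Metric.diam K ∧
      ∀ t, (s, t) ∈ charDomain (direction b) K ↔ t ∈ Ioo 0 (charLength b K s) := by
  have hd : ‖direction b‖ = 1 := by
    rw [direction, norm_smul, norm_inv, norm_norm, inv_mul_cancel₀ (norm_ne_zero_iff.2 hb)]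
  obtain ⟨t₀, ht₀⟩ := exists_mem_charDomain_of_mem_inflow hd hs
  obtain ⟨r, ht₀r, hrf, hr⟩ := exists_first_exit hd hK hKb ht₀.1 ht₀.2
  have hr0 : 0 < r := lt_trans ht₀.1 ht₀r
  -- The segment before the exit point lies in `K`, so the normal there has a nonnegative component
  -- along `b`; transversality makes it positive.
  have hout : s + r • direction b ∈ outflow b K := by
    obtain ⟨ν, hν, hne⟩ := htr _ hrf (projection_add_smul s r)
    have h0 : 0 ≤ ⟪direction b, ν⟫ := by
      refine hν.inner_nonneg_of_backward hr0 hd fun τ hτ => ?_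
      have := hr (r - τ) ⟨by linarith [hτ.2], by linarith [hτ.1]⟩
      convert this using 1
      module
    refine ⟨hrf, ?_⟩
    rw [hν.outerNormal_eq]
    have hpos : 0 < ⟪direction b, ν⟫ := lt_of_le_of_ne h0 hne.symm
    rw [direction, inner_smul_left] at hpos
    exact pos_of_mul_pos_right hpos (by simp)
  have hfK : ∀ z ∈ frontier K, z ∉ K := fun z hz => by
    rw [hK.frontier_eq] at hz; exact hz.2
  have hlen : charLength b K s = r := by
    -- Earlier points of the ray are interior to `K`, so none of them can be an outflow point.
    refine IsLeast.csInf_eq ⟨⟨hr0, hout⟩, fun t ht => ?_⟩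
    by_contra hlt
    exact hfK _ ht.2.1 (hr t ⟨ht.1, not_le.1 hlt⟩)
  rw [hlen]
  refine ⟨hr0, ?_, fun t => ⟨fun ht => ⟨ht.1, ?_⟩, fun ht => ⟨ht.1, fun τ hτ =>
    hr τ ⟨hτ.1, lt_of_le_of_lt hτ.2 ht.2⟩⟩⟩⟩
  · have := Metric.dist_le_diam_of_mem hKb.closure (frontier_subset_closure hrf)
      (frontier_subset_closure hs.1)
    rw [Metric.diam_closure, dist_eq_norm, add_sub_cancel_left, norm_smul, hd, mul_one,
      Real.norm_of_nonneg hr0.le] at this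
    exact this
  · by_contra hge
    exact hfK _ hrf (ht.2 r ⟨hr0, not_lt.1 hge⟩)

end Characteristics

/-! ### Fubini along lines and the change of variables on the inflow boundary. -/

noncomputable section ChangeOfVariables

open Measure Module
open scoped NNReal ENNReal RealInnerProductSpace

variable {E : Type*} [NormedAddCommGroup E] [InnerProductSpace ℝ E]
  [FiniteDimensional ℝ E] [MeasurableSpace E] [BorelSpace E]
  {d : E} {K : Set E} {m : ℕ}

/-- Integration over the space, first along the lines with direction `d`. -/
theorem lintegral_eq_lintegral_lines (hrank : finrank ℝ E = m + 1) (hd : ‖d‖ = 1)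
    {f : E → ℝ≥0∞} (hf : Measurable f) :
    ∫⁻ x, f x = ∫⁻ y : (ℝ ∙ d)ᗮ, (∫⁻ t : ℝ, f (y + t • d)) ∂(μHE[m]) := by
  have hm := finrank_orthogonal_unit hrank hd
  have hmp := ((ℝ ∙ d).measurePreserving_measurableEquivProd (0 : E)).symm
  rw [InnerProductSpace.euclideanHausdorffMeasure_eq_volume] at hmp
  rw [← hm, InnerProductSpace.euclideanHausdorffMeasure_eq_volume,
    hmp.lintegral_map_equiv f, volume_eq_prod, lintegral_prod_symm]
  · refine lintegral_congr fun y => ?_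
    have hmp2 := (LinearIsometryEquiv.toSpanUnitSingleton (𝕜 := ℝ) d hd).measurePreserving
    rw [← hmp2.lintegral_comp_emb
      (LinearIsometryEquiv.toSpanUnitSingleton (𝕜 := ℝ) d hd).toHomeomorph.measurableEmbedding]
    refine lintegral_congr fun t => ?_
    congr 1
    simp [add_comm]
  · exact (hf.comp (MeasurableEquiv.measurable _)).aemeasurable

theorem IsInflowPiece.measurableEmbedding {A : Set E} (hA : IsInflowPiece m d K A)
    (hinj : InjOn (ℝ ∙ d)ᗮ.orthogonalProjectionOnto A) :
    MeasurableEmbedding (fun a : A => (ℝ ∙ d)ᗮ.orthogonalProjectionOnto (a : E)) :=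
  ContinuousOn.measurableEmbedding (f := (ℝ ∙ d)ᗮ.orthogonalProjectionOnto) hA.measurableSet
    (ContinuousLinearMap.continuous _).continuousOn hinj

/-- Change of variables between a piece of the inflow boundary and its projection. -/
theorem IsInflowPiece.lintegral_projection {A : Set E} (hA : IsInflowPiece m d K A)
    (hinj : InjOn (ℝ ∙ d)ᗮ.orthogonalProjectionOnto A) {G : E → ℝ≥0∞} (hG : Measurable G)
    {H : (ℝ ∙ d)ᗮ → ℝ≥0∞} (hGH : ∀ s ∈ A, H ((ℝ ∙ d)ᗮ.orthogonalProjectionOnto s) = G s) :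
    ∫⁻ y in (ℝ ∙ d)ᗮ.orthogonalProjectionOnto '' A, H y ∂(μHE[m])
      = ∫⁻ s in A, ENNReal.ofReal |⟪d, outerNormal K s⟫| * G s ∂(μHE[m]) := by
  set P := (ℝ ∙ d)ᗮ.orthogonalProjectionOnto with hP
  obtain ⟨θ, hθm, hθ⟩ := hA.exists_density
  have hemb := hA.measurableEmbedding hinj
  set ρ : Measure E := (μHE[m] : Measure E).withDensity fun s => ENNReal.ofReal (θ s)
  -- The identity for all subsets of `A` says that the projection pushes the measure with density
  -- `|⟪d, n⟫|` forward to the measure of the hyperplane. As it is a measurable embedding, no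
  -- measurability of `H` is needed to integrate.
  have hmap : (ρ.comap (Subtype.val : A → E)).map (fun a : A => P (a : E))
      = (μHE[m] : Measure (ℝ ∙ d)ᗮ).restrict (P '' A) := by
    ext C hC
    have hpre : (Subtype.val : A → E) '' ((fun a : A => P (a : E)) ⁻¹' C) = A ∩ P ⁻¹' C := by
      ext x
      simp
      tauto
    have hB : MeasurableSet (A ∩ P ⁻¹' C) :=
      hA.measurableSet.inter (P.measurable hC)
    rw [hemb.map_apply, comap_apply _ Subtype.val_injective
      (fun s hs => hA.measurableSet.subtype_image hs) _ (hemb.measurable hC), hpre,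
      withDensity_apply _ hB, restrict_apply hC, inter_comm C, ← image_inter_preimage,
      hA.measure_projection _ inter_subset_left hB (hinj.mono inter_subset_left)]
    exact setLIntegral_congr_fun hB fun s hs => by simp only [hθ s hs.1]
  rw [← hmap, hemb.lintegral_map]
  have h1 : ∫⁻ a : A, H (P (a : E)) ∂(ρ.comap Subtype.val) = ∫⁻ a : A, G a ∂(ρ.comap Subtype.val) :=
    lintegral_congr fun a => hGH a a.2
  rw [h1, lintegral_subtype_comap hA.measurableSet, restrict_withDensity hA.measurableSet,
    lintegral_withDensity_eq_lintegral_mul _ hθm.ennreal_ofReal hG]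
  exact setLIntegral_congr_fun hA.measurableSet fun s hs => by
    simp only [Pi.mul_apply, hθ s hs]

theorem IsInflowPiece.measurable_of_comp {A : Set E} (hA : IsInflowPiece m d K A)
    (hinj : InjOn (ℝ ∙ d)ᗮ.orthogonalProjectionOnto A) {G : E → ℝ≥0∞} (hG : Measurable G)
    {H : (ℝ ∙ d)ᗮ → ℝ≥0∞} (hGH : ∀ s ∈ A, H ((ℝ ∙ d)ᗮ.orthogonalProjectionOnto s) = G s)
    (hH : ∀ y, y ∉ (ℝ ∙ d)ᗮ.orthogonalProjectionOnto '' A → H y = 0) : Measurable H := by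
  have hemb := hA.measurableEmbedding hinj
  obtain ⟨g, hg, hgG⟩ := hemb.exists_measurable_extend (hG.comp measurable_subtype_coe)
    fun _ => ⟨0⟩
  have hrange : MeasurableSet ((ℝ ∙ d)ᗮ.orthogonalProjectionOnto '' A) := by
    have := hemb.measurableSet_range
    rwa [← image_eq_range] at this
  have : H = ((ℝ ∙ d)ᗮ.orthogonalProjectionOnto '' A).indicator g := by
    ext y
    by_cases hy : y ∈ (ℝ ∙ d)ᗮ.orthogonalProjectionOnto '' A
    · rw [indicator_of_mem hy]
      obtain ⟨s, hs, rfl⟩ := hy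
      rw [hGH s hs]
      exact (congrFun hgG ⟨s, hs⟩).symm
    · rw [indicator_of_notMem hy, hH y hy]
  rw [this]
  exact hg.indicator hrange

/-- The converse transfer of null sets, from the hyperplane to the surface: the Jacobian integrates
to zero over the preimage, and it is strictly positive on inflow points. -/
theorem IsInflowPiece.measure_inter_preimage_null {A : Set E} (hA : IsInflowPiece m d K A)
    (hinj : InjOn (ℝ ∙ d)ᗮ.orthogonalProjectionOnto A) {N : Set (ℝ ∙ d)ᗮ}
    (hN : (μHE[m] : Measure (ℝ ∙ d)ᗮ) N = 0) :
    (μHE[m] : Measure E) (A ∩ (ℝ ∙ d)ᗮ.orthogonalProjectionOnto ⁻¹' N) = 0 := by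
  obtain ⟨θ, hθm, hθ⟩ := hA.exists_density
  set N' := toMeasurable (μHE[m] : Measure (ℝ ∙ d)ᗮ) N
  have hN' : (μHE[m] : Measure (ℝ ∙ d)ᗮ) N' = 0 := by rw [measure_toMeasurable, hN]
  set B := A ∩ (ℝ ∙ d)ᗮ.orthogonalProjectionOnto ⁻¹' N'
  have hB : MeasurableSet B := hA.measurableSet.inter
    ((ContinuousLinearMap.measurable _) (measurableSet_toMeasurable _ _))
  have h1 := hA.measure_projection B inter_subset_left hB (hinj.mono inter_subset_left)
  have h2 : (μHE[m] : Measure (ℝ ∙ d)ᗮ) ((ℝ ∙ d)ᗮ.orthogonalProjectionOnto '' B) = 0 :=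
    measure_mono_null (image_subset_iff.2 fun x hx => hx.2) hN'
  have h3 : ∫⁻ s in B, ENNReal.ofReal (θ s) ∂(μHE[m]) = 0 := by
    rw [← h2, h1]
    exact setLIntegral_congr_fun hB fun s hs => by simp only [hθ s hs.1]
  have h4 : ¬ 0 < (μHE[m] : Measure E) (Function.support (fun s => ENNReal.ofReal (θ s)) ∩ B) := by
    rw [← setLIntegral_pos_iff hθm.ennreal_ofReal, h3]
    exact lt_irrefl _
  have h5 : (μHE[m] : Measure E) (Function.support (fun s => ENNReal.ofReal (θ s)) ∩ B) = 0 :=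
    le_antisymm (not_lt.1 h4) zero_le
  refine measure_mono_null ?_ h5
  intro s hs
  refine ⟨?_, hs.1, subset_toMeasurable _ _ hs.2⟩
  have : 0 < θ s := by
    rw [hθ s hs.1]
    exact abs_pos.2 (hA.subset hs.1).2.ne
  simpa using this

/-- A line may enter `K` several times, so the projection need not be injective on a chart piece.
Splitting by a rational height `q` reached by the characteristic restores injectivity, since
distinct entry points on a line have disjoint characteristics. -/
theorem IsLipschitzDomain.exists_inflow_partition (hrank : finrank ℝ E = m + 1)
    (hd : ‖d‖ = 1) (hK : IsLipschitzDomain K) :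
    ∃ A : ℕ → Set E, (∀ n, IsInflowPiece m d K (A n)) ∧
      (∀ n, InjOn (ℝ ∙ d)ᗮ.orthogonalProjectionOnto (A n)) ∧
      Pairwise (Function.onFun Disjoint A) ∧
      (μHE[m] : Measure E) (inflow d K \ ⋃ n, A n) = 0 ∧
      ∃ Z : Set (ℝ ∙ d)ᗮ, (μHE[m] : Measure (ℝ ∙ d)ᗮ) Z = 0 ∧ ∀ s ∈ frontier K,
        (ℝ ∙ d)ᗮ.orthogonalProjectionOnto s ∉ Z → ∃ ν, IsOuterNormal K s ν ∧ ⟪d, ν⟫ ≠ 0 := by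
  obtain ⟨t, S, hS, hcover, hZ⟩ := hK.exists_inflow_cover hrank hd
  have hfK : ∀ z ∈ frontier K, z ∉ K := fun z hz => by
    rw [hK.isOpen.frontier_eq] at hz; exact hz.2
  set Q : E → ℚ → Set E := fun x q => S x ∩ {s | (s, (q : ℝ) - ⟪d, s⟫) ∈ charDomain d K} with hQ
  have hQm : ∀ x ∈ t, ∀ q, MeasurableSet (Q x q) := fun x hx q => by
    refine (hS x hx).measurableSet.inter ?_
    have hc : Continuous fun s : E => (s, (q : ℝ) - ⟪d, s⟫) := by fun_prop
    exact hc.measurable (measurableSet_charDomain d hK.isOpen)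
  -- The extra empty piece keeps the index set nonempty, so that `ℕ` surjects onto it even if `t` is
  -- empty.
  let B : Option (t × ℚ) → Set E := fun o => o.elim ∅ fun i => Q i.1 i.2
  have hempty : IsInflowPiece m d K ∅ := by
    refine ⟨empty_subset _, MeasurableSet.empty, ⟨0, measurable_const, fun s hs => hs.elim⟩, ?_⟩
    intro B hB _ _
    rw [subset_empty_iff.1 hB]
    simp
  have hB : ∀ o, IsInflowPiece m d K (B o) := by
    rintro (_ | ⟨⟨x, hx⟩, q⟩)
    · exact hempty
    · exact (hS x hx).mono inter_subset_left (hQm x hx q)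
  have hBinj : ∀ o, InjOn (ℝ ∙ d)ᗮ.orthogonalProjectionOnto (B o) := by
    rintro (_ | ⟨⟨x, hx⟩, q⟩)
    · exact injOn_empty _
    · intro s hs s' hs' hP
      exact eq_of_mem_charDomain hd (hfK _ ((hS x hx).subset hs.1).1)
        (hfK _ ((hS x hx).subset hs'.1).1) hP hs.2 hs'.2
  obtain ⟨f, hf⟩ := exists_surjective_nat (Option (t × ℚ))
  have hDm : ∀ n, MeasurableSet (disjointed (fun n => B (f n)) n) :=
    MeasurableSet.disjointed fun n => (hB (f n)).measurableSet
  refine ⟨disjointed fun n => B (f n), fun n => (hB (f n)).mono (disjointed_subset _ _) (hDm n),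
    fun n => (hBinj (f n)).mono (disjointed_subset _ _), disjoint_disjointed _, ?_, hZ⟩
  rw [iUnion_disjointed]
  refine measure_mono_null (sdiff_subset_sdiff_right ?_) hcover
  intro s hs
  obtain ⟨x, hx, hsx⟩ := mem_iUnion₂.1 hs
  obtain ⟨r, hr⟩ := exists_mem_charDomain_of_mem_inflow hd ((hS x hx).subset hsx)
  have hr0 : 0 < r := hr.1
  obtain ⟨q, hq1, hq2⟩ := exists_rat_btwn (show ⟪d, s⟫ < ⟪d, s⟫ + r by linarith)
  obtain ⟨n, hn⟩ := hf (some (⟨x, hx⟩, q))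
  refine mem_iUnion.2 ⟨n, ?_⟩
  simp only [hn]
  exact ⟨hsx, by simp only; linarith, fun τ hτ => hr.2 τ ⟨hτ.1, by
    have := hτ.2; simp only at this ⊢; linarith⟩⟩

end ChangeOfVariables

/-! ### Integration over `K` along the characteristics. -/

noncomputable section Coarea

open Measure Module
open scoped NNReal ENNReal RealInnerProductSpace

variable {E : Type*} [NormedAddCommGroup E] [InnerProductSpace ℝ E]
  [FiniteDimensional ℝ E] [MeasurableSpace E] [BorelSpace E]
  {d : E} {K : Set E} {m : ℕ}

/-- Every point of `K` lies on a characteristic entering through the inflow boundary, if the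
boundary points on the line through it are transversal. -/
theorem exists_entry_point (hd : ‖d‖ = 1) (hK : IsOpen K) (hKb : Bornology.IsBounded K) {x : E}
    (hx : x ∈ K) (htr : ∀ z ∈ frontier K, (ℝ ∙ d)ᗮ.orthogonalProjectionOnto z =
      (ℝ ∙ d)ᗮ.orthogonalProjectionOnto x → ∃ ν, IsOuterNormal K z ν ∧ ⟪d, ν⟫ ≠ 0) :
    ∃ s ∈ inflow d K, (ℝ ∙ d)ᗮ.orthogonalProjectionOnto s = (ℝ ∙ d)ᗮ.orthogonalProjectionOnto x ∧
      (s, ⟪d, x⟫ - ⟪d, s⟫) ∈ charDomain d K := by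
  have hnd : ‖-d‖ = 1 := by rw [norm_neg, hd]
  have hc : Continuous fun t : ℝ => x + t • (-d) := by fun_prop
  have h0 : (fun t : ℝ => x + t • (-d)) ⁻¹' K ∈ 𝓝 (0 : ℝ) :=
    (hK.preimage hc).mem_nhds (by simpa using hx)
  obtain ⟨δ, hδ, hball⟩ := Metric.mem_nhds_iff.1 h0
  -- The entry point is the first exit of the backward ray from `x`.
  obtain ⟨r, hδr, hrf, hr⟩ := exists_first_exit (x := x) (t₀ := δ / 2) hnd hK hKb (half_pos hδ)
    fun τ hτ => by
      have hτ2 : τ ≤ δ / 2 := hτ.2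
      have : τ ∈ Metric.ball (0 : ℝ) δ := by
        rw [Metric.mem_ball, dist_zero_right, Real.norm_of_nonneg hτ.1.le]
        linarith
      exact hball this
  have hr0 : 0 < r := (half_pos hδ).trans hδr
  set s := x + r • (-d) with hs
  have hsx : s = x + (-r) • d := by rw [hs]; module
  have hP : (ℝ ∙ d)ᗮ.orthogonalProjectionOnto s = (ℝ ∙ d)ᗮ.orthogonalProjectionOnto x := by
    rw [hsx, projection_add_smul]
  have hds : ⟪d, s⟫ = ⟪d, x⟫ - r := by rw [hsx, inner_add_smul_self hd]; ring
  have hfwd : ∀ τ ∈ Ioc 0 r, s + τ • d ∈ K := by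
    intro τ hτ
    have e : s + τ • d = x + (r - τ) • (-d) := by rw [hs]; module
    rw [e]
    rcases hτ.2.eq_or_lt with h | h
    · rw [h]; simpa using hx
    · exact hr _ ⟨by linarith, by linarith [hτ.1]⟩
  obtain ⟨ν, hν, hne⟩ := htr s hrf hP
  refine ⟨s, ⟨hrf, ?_⟩, hP, ?_, ?_⟩
  · rw [hν.outerNormal_eq]
    exact lt_of_le_of_ne (hν.inner_nonpos_of_forward hr0 hd
      fun τ hτ => hfwd τ ⟨hτ.1, hτ.2.le⟩) hne
  · simp only [hds]; linarith
  · simp only [hds, sub_sub_cancel]; exact hfwd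

/-- The part of the line through `y` with direction `d` (parametrized by the height) covered by
the characteristics entering through `A`. -/
def lineTrace (d : E) (K A : Set E) (y : (ℝ ∙ d)ᗮ) : Set ℝ :=
  {t | ∃ s ∈ A, (ℝ ∙ d)ᗮ.orthogonalProjectionOnto s = y ∧ (s, t - ⟪d, s⟫) ∈ charDomain d K}

/-- The integral of `F` over the characteristic entering at `s`. -/
def charIntegral (d : E) (K : Set E) (F : E → ℝ≥0∞) (s : E) : ℝ≥0∞ :=
  ∫⁻ t in {t : ℝ | (s, t) ∈ charDomain d K}, F (s + t • d)

theorem measurableSet_charDomain_section (hK : IsOpen K) (s : E) :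
    MeasurableSet {t : ℝ | (s, t) ∈ charDomain d K} :=
  measurable_prodMk_left (measurableSet_charDomain d hK)

theorem measurable_charIntegral (hK : IsOpen K) {F : E → ℝ≥0∞} (hF : Measurable F) :
    Measurable (charIntegral d K F) := by
  have h1 : Measurable fun p : E × ℝ =>
      (charDomain d K).indicator (fun p : E × ℝ => F (p.1 + p.2 • d)) p := by
    refine Measurable.indicator (hF.comp ?_) (measurableSet_charDomain d hK)
    exact Continuous.measurable (by fun_prop)
  have h2 := h1.lintegral_prod_right' (ν := volume)
  convert h2 using 2 with s
  rw [charIntegral, ← lintegral_indicator (measurableSet_charDomain_section hK s)]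
  rfl

theorem lineTrace_projection {A : Set E}
    (hinj : InjOn (ℝ ∙ d)ᗮ.orthogonalProjectionOnto A) {s : E} (hs : s ∈ A) :
    lineTrace d K A ((ℝ ∙ d)ᗮ.orthogonalProjectionOnto s)
      = (fun t => t - ⟪d, s⟫) ⁻¹' {t : ℝ | (s, t) ∈ charDomain d K} := by
  ext t
  constructor
  · rintro ⟨s', hs', hP, h⟩
    rw [hinj hs' hs hP] at h
    exact h
  · intro h
    exact ⟨s, hs, rfl, h⟩

theorem measurableSet_lineTrace (hK : IsOpen K) {A : Set E}
    (hinj : InjOn (ℝ ∙ d)ᗮ.orthogonalProjectionOnto A) (y : (ℝ ∙ d)ᗮ) :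
    MeasurableSet (lineTrace d K A y) := by
  by_cases hy : y ∈ (ℝ ∙ d)ᗮ.orthogonalProjectionOnto '' A
  · obtain ⟨s, hs, rfl⟩ := hy
    rw [lineTrace_projection hinj hs]
    exact (measurable_id.sub_const _) (measurableSet_charDomain_section hK s)
  · have : lineTrace d K A y = ∅ := by
      ext t
      simp only [mem_empty_iff_false, iff_false]
      rintro ⟨s, hs, hP, -⟩
      exact hy ⟨s, hs, hP⟩
    rw [this]
    exact MeasurableSet.empty

/-- Translation by `⟪d, s⟫` passes from height on the line to arc length from the entry point. -/
theorem lintegral_lineTrace_projection (hK : IsOpen K) (hd : ‖d‖ = 1) {A : Set E}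
    (hinj : InjOn (ℝ ∙ d)ᗮ.orthogonalProjectionOnto A) (F : E → ℝ≥0∞) {s : E} (hs : s ∈ A) :
    ∫⁻ t in lineTrace d K A ((ℝ ∙ d)ᗮ.orthogonalProjectionOnto s),
        F (((ℝ ∙ d)ᗮ.orthogonalProjectionOnto s : E) + t • d)
      = charIntegral d K F s := by
  rw [← lintegral_indicator (measurableSet_lineTrace hK hinj _), charIntegral,
    ← lintegral_indicator (measurableSet_charDomain_section hK s)]
  refine Eq.trans ?_ (lintegral_sub_right_eq_self (μ := (volume : Measure ℝ)) _ ⟪d, s⟫)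
  refine lintegral_congr fun t => ?_
  rw [lineTrace_projection hinj hs]
  have : s + (t - ⟪d, s⟫) • d = ((ℝ ∙ d)ᗮ.orthogonalProjectionOnto s : E) + t • d := by
    rw [coe_orthogonalProjectionOnto_orthogonal_span hd]; module
  simp only [indicator, this]
  rfl

/-- The integral over a Lipschitz domain as an iterated integral over the inflow boundary and
the characteristics. -/
theorem IsLipschitzDomain.exists_characteristic_decomposition (hrank : finrank ℝ E = m + 1)
    {b : E} (hb : b ≠ 0) (hK : IsLipschitzDomain K) :
    (∀ᵐ s ∂((μHE[m] : Measure E).restrict (inflow (direction b) K)),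
      0 < charLength b K s ∧ charLength b K s ≤ Metric.diam K ∧
      (∀ t, (s, t) ∈ charDomain (direction b) K ↔ t ∈ Ioo 0 (charLength b K s)) ∧
      0 < |⟪direction b, outerNormal K s⟫|) ∧
    AEMeasurable (fun s => |⟪direction b, outerNormal K s⟫|)
      ((μHE[m] : Measure E).restrict (inflow (direction b) K)) ∧
    ∀ F : E → ℝ≥0∞, Measurable F → ∫⁻ x in K, F x =
      ∫⁻ s in inflow (direction b) K, ENNReal.ofReal |⟪direction b, outerNormal K s⟫|
        * charIntegral (direction b) K F s ∂(μHE[m]) := by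
  have hd : ‖direction b‖ = 1 := by
    rw [direction, norm_smul, norm_inv, norm_norm, inv_mul_cancel₀ (norm_ne_zero_iff.2 hb)]
  set d := direction b
  obtain ⟨A, hA, hinj, hdisj, hcover, Z, hZ0, hZ⟩ := hK.exists_inflow_partition hrank hd
  set P := (ℝ ∙ d)ᗮ.orthogonalProjectionOnto with hP
  have hKo := hK.isOpen
  have hKb := hK.isBounded
  have hfK : ∀ z ∈ frontier K, z ∉ K := fun z hz => by
    rw [hKo.frontier_eq] at hz; exact hz.2
  have hsub : (⋃ n, A n) ⊆ inflow d K := iUnion_subset fun n => (hA n).subset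
  have hAm : MeasurableSet (⋃ n, A n) := MeasurableSet.iUnion fun n => (hA n).measurableSet
  have hae : inflow d K =ᵐ[(μHE[m] : Measure E)] ⋃ n, A n :=
    (ae_le_set.2 hcover).antisymm hsub.eventuallyLE
  rw [restrict_congr_set hae]
  refine ⟨?_, ?_, fun F hF => ?_⟩
  · have hnull : (μHE[m] : Measure E) ((⋃ n, A n) ∩ P ⁻¹' Z) = 0 := by
      rw [iUnion_inter]
      exact measure_iUnion_null fun n => (hA n).measure_inter_preimage_null (hinj n) hZ0
    rw [ae_restrict_iff' hAm]
    have : ∀ᵐ s ∂(μHE[m] : Measure E), s ∉ (⋃ n, A n) ∩ P ⁻¹' Z :=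
      measure_eq_zero_iff_ae_notMem.1 hnull
    filter_upwards [this] with s hs hsA
    have hsZ : P s ∉ Z := fun h => hs ⟨hsA, h⟩
    have hsi := hsub hsA
    obtain ⟨h1, h2, h3⟩ := charDomain_iff_of_transversal hb hKo hKb hsi
      fun z hz hPz => hZ z hz (by rwa [show P z = P s from hPz])
    exact ⟨h1, h2, h3, abs_pos.2 hsi.2.ne⟩
  · refine AEMeasurable.iUnion fun n => ?_
    obtain ⟨θ, hθm, hθ⟩ := (hA n).exists_density
    refine hθm.aemeasurable.congr ?_
    rw [EventuallyEq, ae_restrict_iff' (hA n).measurableSet]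
    exact Eventually.of_forall hθ
  · have hG := measurable_charIntegral (d := d) hKo hF
    set H : ℕ → (ℝ ∙ d)ᗮ → ℝ≥0∞ := fun n y =>
      ∫⁻ t in lineTrace d K (A n) y, F ((y : E) + t • d) with hH
    have hHP : ∀ n, ∀ s ∈ A n, H n (P s) = charIntegral d K F s := fun n s hs =>
      lintegral_lineTrace_projection hKo hd (hinj n) F hs
    have hH0 : ∀ n, ∀ y, y ∉ P '' A n → H n y = 0 := by
      intro n y hy
      have : lineTrace d K (A n) y = ∅ := by
        ext t
        simp only [mem_empty_iff_false, iff_false]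
        rintro ⟨s, hs, hPs, -⟩
        exact hy ⟨s, hs, hPs⟩
      simp [hH, this]
    have hHm : ∀ n, Measurable (H n) := fun n =>
      (hA n).measurable_of_comp (hinj n) hG (hHP n) (hH0 n)
    -- Lines to discard: those with a non-transversal boundary point, and those meeting the part of
    -- the inflow boundary missed by the pieces.
    have hZ' : (μHE[m] : Measure (ℝ ∙ d)ᗮ) (Z ∪ P '' (inflow d K \ ⋃ n, A n)) = 0 := by
      refine measure_union_null hZ0 (le_antisymm ?_ zero_le)
      exact (measure_projection_image_le d _).trans hcover.le
    have hline : ∀ᵐ y : (ℝ ∙ d)ᗮ ∂(μHE[m] : Measure (ℝ ∙ d)ᗮ),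
        ∫⁻ t : ℝ, K.indicator F ((y : E) + t • d) = ∑' n, H n y := by
      filter_upwards [measure_eq_zero_iff_ae_notMem.1 hZ'] with y hy
      have hPy : ∀ t : ℝ, P ((y : E) + t • d) = y := fun t => by
        rw [hP, projection_add_smul, Submodule.orthogonalProjectionOnto_mem_subspace_eq_self]
      -- On a good line every point of `K` has an entry point, which lies in some piece; with `hdis`
      -- this splits the section of `K` into disjoint traces.
      have hset : {t : ℝ | (y : E) + t • d ∈ K} = ⋃ n, lineTrace d K (A n) y := by
        ext t
        rw [mem_iUnion]
        constructor
        · intro ht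
          obtain ⟨s, hs, hPs, hmem⟩ := exists_entry_point hd hKo hKb ht
            fun z hz hPz => hZ z hz fun h => hy (Or.inl (by rwa [hPz, ← hP, hPy] at h))
          rw [← hP, hPy] at hPs
          have hsA : s ∈ ⋃ n, A n := by
            by_contra h
            exact hy (Or.inr ⟨s, ⟨hs, h⟩, hPs⟩)
          obtain ⟨n, hn⟩ := mem_iUnion.1 hsA
          rw [inner_add_smul_self hd, inner_coe_orthogonal, zero_add] at hmem
          exact ⟨n, s, hn, hPs, hmem⟩
        · rintro ⟨n, s, hs, hPs, hmem⟩
          have h1 := hmem.2 _ ⟨hmem.1, le_rfl⟩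
          have h2 : s + (t - ⟪d, s⟫) • d = (y : E) + t • d := by
            rw [← hPs, coe_orthogonalProjectionOnto_orthogonal_span hd]; module
          simp only [h2] at h1
          exact h1
      have hdis : Pairwise (Function.onFun Disjoint fun n => lineTrace d K (A n) y) := by
        intro i j hij
        rw [Function.onFun, Set.disjoint_left]
        rintro t ⟨s, hs, hPs, hmem⟩ ⟨s', hs', hPs', hmem'⟩
        have := eq_of_mem_charDomain hd (hfK _ ((hA i).subset hs).1)
          (hfK _ ((hA j).subset hs').1) (hPs.trans hPs'.symm) hmem hmem'
        exact Set.disjoint_left.1 (hdisj hij) hs (this ▸ hs')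
      have hind : ∀ t : ℝ, K.indicator F ((y : E) + t • d)
          = (⋃ n, lineTrace d K (A n) y).indicator (fun t => F ((y : E) + t • d)) t := by
        intro t
        rw [← hset]
        rfl
      simp_rw [hind]
      rw [lintegral_indicator (MeasurableSet.iUnion fun n => measurableSet_lineTrace hKo (hinj n) y),
        lintegral_iUnion (fun n => measurableSet_lineTrace hKo (hinj n) y) hdis]
    rw [← lintegral_indicator hKo.measurableSet,
      lintegral_eq_lintegral_lines hrank hd (hF.indicator hKo.measurableSet), lintegral_congr_ae hline,
      lintegral_tsum fun n => (hHm n).aemeasurable,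
      lintegral_iUnion (fun n => (hA n).measurableSet) hdisj]
    refine tsum_congr fun n => ?_
    rw [← (hA n).lintegral_projection (hinj n) hG (hHP n), ← lintegral_indicator]
    · refine lintegral_congr fun y => ?_
      by_cases hy : y ∈ P '' A n
      · rw [indicator_of_mem hy]
      · rw [indicator_of_notMem hy, hH0 n y hy]
    · have := ((hA n).measurableEmbedding (hinj n)).measurableSet_range
      rwa [← image_eq_range] at this

end Coarea

/-! ### Weak directional derivatives as increments along lines. -/

noncomputable section Lines

open Measure

variable {E : Type*} [NormedAddCommGroup E] [NormedSpace ℝ E] [FiniteDimensional ℝ E]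
  [MeasureSpace E] [BorelSpace E] [(volume : Measure E).IsAddHaarMeasure]

/-- The points from which the segment in direction `h • d` stays in `K`. -/
def segmentDomain (d : E) (K : Set E) (h : ℝ) : Set E :=
  {x | ∀ θ ∈ Icc (0 : ℝ) 1, x + (θ * h) • d ∈ K}

theorem isOpen_segmentDomain (d : E) {K : Set E} (hK : IsOpen K) (h : ℝ) :
    IsOpen (segmentDomain d K h) := by
  have hc : Continuous fun x : E => (x, h) := by fun_prop
  exact (isOpen_segment_subset d hK 0).preimage hc

theorem measurable_line (d : E) (h : ℝ) :
    Measurable fun p : ℝ × E => p.2 + (p.1 * h) • d :=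
  Continuous.measurable (by fun_prop)

theorem integrable_prod_line {w : E → ℝ} (hw : Measurable w) (hwi : Integrable w) (d : E) (h : ℝ) :
    Integrable (fun p : ℝ × E => w (p.2 + (p.1 * h) • d))
      ((volume.restrict (uIoc (0 : ℝ) 1)).prod volume) := by
  have hfin : IsFiniteMeasure (volume.restrict (uIoc (0 : ℝ) 1)) := by
    rw [uIoc_of_le zero_le_one]; infer_instance
  have hm : AEStronglyMeasurable (fun p : ℝ × E => w (p.2 + (p.1 * h) • d))
      ((volume.restrict (uIoc (0 : ℝ) 1)).prod volume) :=
    (hw.comp (measurable_line d h)).aestronglyMeasurable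
  rw [integrable_prod_iff hm]
  constructor
  · exact Eventually.of_forall fun θ => hwi.comp_add_right ((θ * h) • d)
  · have : (fun θ : ℝ => ∫ x, ‖w (x + (θ * h) • d)‖) = fun _ => ∫ x, ‖w x‖ := by
      ext θ
      exact integral_add_right_eq_self (fun x => ‖w x‖) _
    simp only [this]
    exact integrable_const _

theorem integrable_mul_of_continuous_compactSupport {α : Type*} [MeasurableSpace α]
    {μ : Measure α} {f : α → ℝ} (hf : Integrable f μ) {g : E → ℝ} (hg : Continuous g)
    (hgc : HasCompactSupport g) {T : α → E} (hT : Measurable T) :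
    Integrable (fun p => f p * g (T p)) μ := by
  obtain ⟨C, hC⟩ := hgc.exists_bound_of_continuous hg
  exact hf.mul_bdd (c := C) (hg.measurable.comp hT).aestronglyMeasurable
    (Eventually.of_forall fun p => hC _)

theorem integral_translate_mul {f : E → ℝ} (g : E → ℝ) (a : E) :
    ∫ x, f (x + a) * g x = ∫ x, f x * g (x - a) := by
  have := integral_add_right_eq_self (μ := (volume : Measure E)) (fun x => f x * g (x - a)) a
  simp only [add_sub_cancel_right] at this
  exact this

/-- The weak directional derivative as a difference quotient tested against `g`. -/
theorem integral_increment_mul_eq {K : Set E} {d : E} {v w : E → ℝ}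
    (hvi : Integrable v) (hw : Measurable w)
    (hwi : Integrable w) (hv0 : ∀ x, x ∉ K → v x = 0) (hw0 : ∀ x, x ∉ K → w x = 0)
    (hweak : HasWeakDirDeriv d K v w) (h : ℝ) {g : E → ℝ} (hg : ContDiff ℝ ∞ g)
    (hgc : HasCompactSupport g) (hgs : tsupport g ⊆ segmentDomain d K h) :
    ∫ x, v x * (g (x - h • d) - g x)
      = ∫ x, (h * ∫ θ in (0 : ℝ)..1, w (x + (θ * h) • d)) * g x := by
  have hg1 : Differentiable ℝ g := hg.differentiable (by simp)
  have hDc : Continuous fun x => fderiv ℝ g x d :=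
    (hg.continuous_fderiv (by simp)).clm_apply continuous_const
  have hDs : HasCompactSupport fun x => fderiv ℝ g x d := hgc.fderiv_apply ℝ d
  have hderiv : ∀ x : E, ∀ θ : ℝ, HasDerivAt (fun θ : ℝ => g (x - (θ * h) • d))
      (-(h * fderiv ℝ g (x - (θ * h) • d) d)) θ := by
    intro x θ
    have h1 : HasDerivAt (fun θ : ℝ => x - (θ * h) • d) (-(h • d)) θ := by
      have := (((hasDerivAt_id θ).mul_const h).smul_const d).const_sub x
      simpa using this
    have := ((hg1 (x - (θ * h) • d)).hasFDerivAt).comp_hasDerivAt θ h1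
    rw [map_neg, map_smul, smul_eq_mul] at this
    exact this
  have hincr : ∀ x : E, g (x - h • d) - g x
      = ∫ θ in (0 : ℝ)..1, -(h * fderiv ℝ g (x - (θ * h) • d) d) := by
    intro x
    rw [intervalIntegral.integral_eq_sub_of_hasDerivAt (fun θ _ => hderiv x θ)]
    · simp
    · apply Continuous.intervalIntegrable
      have : Continuous fun θ : ℝ => fderiv ℝ g (x - (θ * h) • d) d :=
        hDc.comp (by fun_prop)
      fun_prop
  have hmeas : Measurable fun p : ℝ × E => p.2 - (p.1 * h) • d :=
    Continuous.measurable (by fun_prop)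
  -- The support of `g` lies in `segmentDomain`, so its translates by `(θ * h) • d` stay in `K` and
  -- are admissible test functions. Integrating over `θ` turns the derivative of `g` into an
  -- increment.
  have htest : ∀ θ ∈ Icc (0 : ℝ) 1,
      ∫ x, v x * fderiv ℝ g (x - (θ * h) • d) d = - ∫ x, w x * g (x - (θ * h) • d) := by
    intro θ hθ
    set a := (θ * h) • d
    have hφ : ContDiff ℝ ∞ fun x => g (x - a) := hg.comp (contDiff_id.sub contDiff_const)
    have hφc : HasCompactSupport fun x => g (x - a) :=
      hgc.comp_homeomorph (Homeomorph.subRight a)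
    have hφs : tsupport (fun x => g (x - a)) ⊆ K := by
      have : tsupport (fun x => g (x - a)) = (Homeomorph.subRight a) ⁻¹' tsupport g :=
        tsupport_comp_eq_preimage g (Homeomorph.subRight a)
      rw [this]
      intro x hx
      have := hgs hx θ hθ
      simpa [a] using this
    have := hweak _ hφ hφc hφs
    rw [setIntegral_eq_integral_of_forall_compl_eq_zero fun x hx => by rw [hv0 x hx, zero_mul],
      setIntegral_eq_integral_of_forall_compl_eq_zero fun x hx => by rw [hw0 x hx, zero_mul]]
      at this
    rw [← this]
    refine integral_congr_ae (Eventually.of_forall fun x => ?_)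
    simp only
    rw [fderiv_comp_sub]
  calc ∫ x, v x * (g (x - h • d) - g x)
      = ∫ x, ∫ θ in (0 : ℝ)..1, -h * (v x * fderiv ℝ g (x - (θ * h) • d) d) := by
        refine integral_congr_ae (Eventually.of_forall fun x => ?_)
        beta_reduce
        rw [hincr x, ← intervalIntegral.integral_const_mul]
        refine intervalIntegral.integral_congr fun θ _ => ?_
        ring
    _ = ∫ θ in (0 : ℝ)..1, ∫ x, -h * (v x * fderiv ℝ g (x - (θ * h) • d) d) := by
        rw [intervalIntegral_integral_swap]
        have hfin : IsFiniteMeasure (volume.restrict (uIoc (0 : ℝ) 1)) := by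
          rw [uIoc_of_le zero_le_one]; infer_instance
        have h1 : Integrable (fun p : ℝ × E => v p.2)
            ((volume.restrict (uIoc (0 : ℝ) 1)).prod volume) := hvi.comp_snd _
        exact (integrable_mul_of_continuous_compactSupport h1 hDc hDs hmeas).const_mul (-h)
    _ = ∫ θ in (0 : ℝ)..1, ∫ x, h * (w (x + (θ * h) • d) * g x) := by
        refine intervalIntegral.integral_congr fun θ hθ => ?_
        rw [uIcc_of_le zero_le_one] at hθ
        rw [integral_const_mul, integral_const_mul, htest θ hθ, integral_translate_mul]
        ring
    _ = ∫ x, ∫ θ in (0 : ℝ)..1, h * (w (x + (θ * h) • d) * g x) := by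
        rw [intervalIntegral_integral_swap]
        exact (integrable_mul_of_continuous_compactSupport (integrable_prod_line hw hwi d h)
          hg.continuous hgc measurable_snd).const_mul h
    _ = _ := by
        refine integral_congr_ae (Eventually.of_forall fun x => ?_)
        beta_reduce
        rw [mul_assoc, ← intervalIntegral.integral_mul_const, ← intervalIntegral.integral_const_mul]

/-- The fundamental lemma of the calculus of variations on the open set `segmentDomain d K h`,
applied to the tested identity for fixed `h`. -/
theorem ae_increment_eq {K : Set E} (hK : IsOpen K) {d : E} {v w : E → ℝ}
    (hvi : Integrable v) (hw : Measurable w)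
    (hwi : Integrable w) (hv0 : ∀ x, x ∉ K → v x = 0) (hw0 : ∀ x, x ∉ K → w x = 0)
    (hweak : HasWeakDirDeriv d K v w) (h : ℝ) :
    ∀ᵐ x : E, x ∈ segmentDomain d K h →
      v (x + h • d) - v x - h * ∫ θ in (0 : ℝ)..1, w (x + (θ * h) • d) = 0 := by
  have hI : Integrable fun x : E => h * ∫ θ in (0 : ℝ)..1, w (x + (θ * h) • d) := by
    have := (integrable_prod_line hw hwi d h).integral_prod_right
    simp only [intervalIntegral.integral_of_le (zero_le_one' ℝ)]
    rw [uIoc_of_le zero_le_one] at this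
    exact this.const_mul h
  have hvs : Integrable fun x : E => v (x + h • d) := hvi.comp_add_right _
  apply (isOpen_segmentDomain d hK h).ae_eq_zero_of_integral_contDiff_smul_eq_zero
  · exact ((hvs.sub hvi).sub hI).locallyIntegrable.locallyIntegrableOn _
  · intro g hg hgc hgs
    have key := integral_increment_mul_eq hvi hw hwi hv0 hw0 hweak h hg hgc hgs
    have i1 := integrable_mul_of_continuous_compactSupport hvs hg.continuous hgc measurable_id
    have i2 := integrable_mul_of_continuous_compactSupport hvi hg.continuous hgc measurable_id
    have i3 := integrable_mul_of_continuous_compactSupport hI hg.continuous hgc measurable_id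
    have i4 := integrable_mul_of_continuous_compactSupport hvi hg.continuous hgc
      (measurable_id.sub_const (h • d))
    simp only [id] at i1 i2 i3 i4
    have e1 : ∫ x, v x * (g (x - h • d) - g x)
        = (∫ x, v (x + h • d) * g x) - ∫ x, v x * g x := by
      rw [integral_translate_mul, ← integral_sub i4 i2]
      exact integral_congr_ae (Eventually.of_forall fun x => by simp only; ring)
    have e2 : ∫ x, g x • (v (x + h • d) - v x - h * ∫ θ in (0 : ℝ)..1, w (x + (θ * h) • d))
        = (∫ x, v (x + h • d) * g x) - (∫ x, v x * g x)
          - ∫ x, (h * ∫ θ in (0 : ℝ)..1, w (x + (θ * h) • d)) * g x := by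
      have i12 : Integrable fun x => v (x + h • d) * g x - v x * g x := i1.sub i2
      rw [← integral_sub i1 i2, ← integral_sub i12 i3]
      exact integral_congr_ae (Eventually.of_forall fun x => by
        simp only [smul_eq_mul]; ring)
    rw [e2, ← e1, key, sub_self]

/-- For almost every `x`, a function with a weak directional derivative is, along the line through
`x`, almost everywhere the integral of this derivative. -/
theorem ae_ae_increment_eq {K : Set E} (hK : IsOpen K) {d : E} {v w : E → ℝ} (hv : Measurable v)
    (hvi : Integrable v) (hw : Measurable w)
    (hwi : Integrable w) (hv0 : ∀ x, x ∉ K → v x = 0) (hw0 : ∀ x, x ∉ K → w x = 0)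
    (hweak : HasWeakDirDeriv d K v w) :
    ∀ᵐ x : E, ∀ᵐ h : ℝ, x ∈ segmentDomain d K h →
      v (x + h • d) - v x - h * ∫ θ in (0 : ℝ)..1, w (x + (θ * h) • d) = 0 := by
  -- The exceptional null set depends on `h`; Fubini exchanges the two quantifiers, which needs
  -- joint measurability of the condition.
  rw [ae_ae_comm]
  · exact Eventually.of_forall fun h => ae_increment_eq hK hvi hw hwi hv0 hw0 hweak h
  · have m1 : MeasurableSet {p : E × ℝ | p.1 ∈ segmentDomain d K p.2} :=
      (isOpen_segment_subset d hK 0).measurableSet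
    have m2 : Measurable fun p : E × ℝ => v (p.1 + p.2 • d) :=
      hv.comp (Continuous.measurable (by fun_prop))
    have m3 : Measurable fun p : E × ℝ => ∫ θ in (0 : ℝ)..1, w (p.1 + (θ * p.2) • d) := by
      simp only [intervalIntegral.integral_of_le (zero_le_one' ℝ)]
      have : Measurable fun q : (E × ℝ) × ℝ => w (q.1.1 + (q.2 * q.1.2) • d) :=
        hw.comp (Continuous.measurable (by fun_prop))
      exact this.stronglyMeasurable.integral_prod_right'.measurable
    have m4 : MeasurableSet {p : E × ℝ | v (p.1 + p.2 • d) - v p.1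
        - p.2 * ∫ θ in (0 : ℝ)..1, w (p.1 + (θ * p.2) • d) = 0} :=
      measurableSet_eq_fun ((m2.sub (hv.comp measurable_fst)).sub (measurable_snd.mul m3))
        measurable_const
    exact m1.imp m4

/-- One good base point on a characteristic suffices: with `h = t - t₀` its increments describe `v`
at almost every other point. -/
theorem ae_eq_add_integral_of_base {K : Set E} {d : E} {v w : E → ℝ} {s : E} {r t₀ : ℝ}
    (ht₀ : t₀ ∈ Ioo 0 r) (hs : ∀ t ∈ Ioo 0 r, s + t • d ∈ K)
    (hbase : ∀ᵐ h : ℝ, s + t₀ • d ∈ segmentDomain d K h →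
      v (s + t₀ • d + h • d) - v (s + t₀ • d)
        - h * ∫ θ in (0 : ℝ)..1, w (s + t₀ • d + (θ * h) • d) = 0) :
    ∀ᵐ t ∂(volume.restrict (Ioo 0 r)),
      v (s + t • d) = v (s + t₀ • d) + ∫ τ in t₀..t, w (s + τ • d) := by
  rw [ae_restrict_iff' measurableSet_Ioo]
  have hshift : ∀ᵐ t : ℝ, s + t₀ • d ∈ segmentDomain d K (t - t₀) →
      v (s + t₀ • d + (t - t₀) • d) - v (s + t₀ • d)
        - (t - t₀) * ∫ θ in (0 : ℝ)..1, w (s + t₀ • d + (θ * (t - t₀)) • d) = 0 :=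
    (measurePreserving_sub_right volume t₀).quasiMeasurePreserving.ae hbase
  filter_upwards [hshift] with t ht htr
  have hmem : s + t₀ • d ∈ segmentDomain d K (t - t₀) := by
    intro θ hθ
    have : s + t₀ • d + (θ * (t - t₀)) • d = s + (t₀ + θ * (t - t₀)) • d := by module
    rw [this]
    refine hs _ ⟨?_, ?_⟩
    · nlinarith [ht₀.1, htr.1, hθ.1, hθ.2, mul_nonneg hθ.1 htr.1.le,
        mul_nonneg (sub_nonneg.2 hθ.2) ht₀.1.le]
    · nlinarith [ht₀.2, htr.2, hθ.1, hθ.2, mul_nonneg hθ.1 (sub_nonneg.2 htr.2.le),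
        mul_nonneg (sub_nonneg.2 hθ.2) (sub_nonneg.2 ht₀.2.le)]
  have h1 := ht hmem
  have h2 : s + t₀ • d + (t - t₀) • d = s + t • d := by module
  have h3 : (t - t₀) * ∫ θ in (0 : ℝ)..1, w (s + t₀ • d + (θ * (t - t₀)) • d)
      = ∫ τ in t₀..t, w (s + τ • d) := by
    have := intervalIntegral.mul_integral_comp_add_mul (a := 0) (b := 1)
      (f := fun τ => w (s + τ • d)) (t - t₀) t₀
    simp only [mul_zero, add_zero, mul_one, add_sub_cancel] at this
    rw [← this]
    congr 1
    refine intervalIntegral.integral_congr fun θ _ => ?_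
    congr 1
    module
  rw [h2, h3] at h1
  linarith

end Lines

/-! ### The one-dimensional equivalence. -/

noncomputable section Interval

open Measure

theorem hasWeakDirDeriv_congr {E : Type*} [NormedAddCommGroup E] [NormedSpace ℝ E] [MeasureSpace E]
    {d : E} {K : Set E} {v w v₀ w₀ : E → ℝ} (h : HasWeakDirDeriv d K v w)
    (hv : v =ᵐ[volume.restrict K] v₀) (hw : w =ᵐ[volume.restrict K] w₀) :
    HasWeakDirDeriv d K v₀ w₀ := by
  intro φ hφ hφc hφs
  have h1 : ∫ x in K, v₀ x * fderiv ℝ φ x d = ∫ x in K, v x * fderiv ℝ φ x d :=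
    integral_congr_ae (hv.mono fun x hx => by simp only [hx])
  have h2 : ∫ x in K, w₀ x * φ x = ∫ x in K, w x * φ x :=
    integral_congr_ae (hw.mono fun x hx => by simp only [hx])
  rw [h1, h2]
  exact h φ hφ hφc hφs

/-- A square-integrable function on a set of finite measure agrees on it with a measurable
integrable function that vanishes elsewhere. -/
theorem exists_measurable_representative {E : Type*} [MeasureSpace E] {K : Set E}
    (hK : MeasurableSet K) (hfin : volume K ≠ ⊤) {v : E → ℝ} (hv : MemLp v 2 (volume.restrict K)) :
    ∃ v₀ : E → ℝ, Measurable v₀ ∧ Integrable v₀ ∧ (∀ x, x ∉ K → v₀ x = 0) ∧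
      v =ᵐ[volume.restrict K] v₀ := by
  have hf : IsFiniteMeasure (volume.restrict K) := ⟨by
    rw [restrict_apply_univ]; exact hfin.lt_top⟩
  have hmk := hv.1.ae_eq_mk
  have heq : v =ᵐ[volume.restrict K] K.indicator (hv.1.mk v) :=
    hmk.trans (indicator_ae_eq_restrict hK).symm
  refine ⟨K.indicator (hv.1.mk v), hv.1.stronglyMeasurable_mk.measurable.indicator hK, ?_,
    fun x hx => indicator_of_notMem hx _, heq⟩
  rw [integrable_indicator_iff hK]
  exact (hv.integrable (by norm_num)).congr hmk

theorem intervalIntegrable_of_memLp {r : ℝ} {w : ℝ → ℝ}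
    (hw : MemLp w 2 (volume.restrict (Ioo 0 r))) {a b : ℝ} (ha : a ∈ Icc 0 r) (hb : b ∈ Icc 0 r) :
    IntervalIntegrable w volume a b := by
  have h1 : IntegrableOn w (Icc 0 r) := by
    rw [integrableOn_Icc_iff_integrableOn_Ioo]
    exact hw.integrable (by norm_num)
  refine (intervalIntegrable_iff.2 (h1.mono_set ?_))
  exact uIoc_subset_uIcc.trans (uIcc_subset_Icc ha hb)

theorem absolutelyContinuousOnInterval_primitive {r : ℝ} (hr : 0 < r) {w : ℝ → ℝ}
    (hw : MemLp w 2 (volume.restrict (Ioo 0 r))) {a : ℝ} (ha : a ∈ Icc 0 r) :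
    AbsolutelyContinuousOnInterval (fun t => ∫ τ in a..t, w τ) 0 r :=
  (intervalIntegrable_of_memLp hw (left_mem_Icc.2 hr.le)
    (right_mem_Icc.2 hr.le)).absolutelyContinuousOnInterval_intervalIntegral
    (by rwa [uIcc_of_le hr.le])

theorem continuousOn_primitive {r : ℝ} (hr : 0 < r) {w : ℝ → ℝ}
    (hw : MemLp w 2 (volume.restrict (Ioo 0 r))) {a : ℝ} (ha : a ∈ Icc 0 r) (c : ℝ) :
    ContinuousOn (fun t => c + ∫ τ in a..t, w τ) (Icc 0 r) := by
  have := (absolutelyContinuousOnInterval_primitive hr hw ha).continuousOn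
  rw [uIcc_of_le hr.le] at this
  exact continuousOn_const.add this

/-- Primitives of square-integrable functions have weak derivatives. -/
theorem memH_primitive {r : ℝ} (hr : 0 < r) {w : ℝ → ℝ}
    (hw : MemLp w 2 (volume.restrict (Ioo 0 r))) {a : ℝ} (ha : a ∈ Icc 0 r) (c : ℝ) :
    MemH 1 (Ioo 0 r) (fun t => c + ∫ τ in a..t, w τ) w := by
  set f : ℝ → ℝ := fun t => c + ∫ τ in a..t, w τ with hf
  have hcont : ContinuousOn f (Icc 0 r) := continuousOn_primitive hr hw ha c
  have hac : AbsolutelyContinuousOnInterval f 0 r := by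
    have h1 : AbsolutelyContinuousOnInterval (fun _ : ℝ => c) 0 r :=
      (LipschitzWith.const c).lipschitzOnWith.absolutelyContinuousOnInterval
    exact h1.add (absolutelyContinuousOnInterval_primitive hr hw ha)
  have hderiv : ∀ᵐ t : ℝ, t ∈ uIcc 0 r → deriv f t = w t := by
    filter_upwards [(intervalIntegrable_of_memLp hw (left_mem_Icc.2 hr.le)
      (right_mem_Icc.2 hr.le)).ae_hasDerivAt_integral] with t ht htr
    exact ((ht htr a (by rwa [uIcc_of_le hr.le])).const_add c).deriv
  refine ⟨?_, hw, fun φ hφ hφc hφs => ?_⟩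
  · obtain ⟨C, hC⟩ := isCompact_Icc.exists_bound_of_continuousOn hcont
    refine MemLp.of_bound (hcont.mono Ioo_subset_Icc_self
      |>.aestronglyMeasurable measurableSet_Ioo) C ?_
    rw [ae_restrict_iff' measurableSet_Ioo]
    exact Eventually.of_forall fun t ht => hC t (Ioo_subset_Icc_self ht)
  -- Integration by parts for absolutely continuous functions; the test function vanishes at both
  -- ends.
  · have hφ0 : φ 0 = 0 := image_eq_zero_of_notMem_tsupport fun h => lt_irrefl _ (hφs h).1
    have hφr : φ r = 0 := image_eq_zero_of_notMem_tsupport fun h => lt_irrefl _ (hφs h).2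
    have hφac : AbsolutelyContinuousOnInterval φ 0 r :=
      (hφ.of_le (by simp)).contDiffOn.absolutelyContinuousOnInterval
    have key := hac.integral_mul_deriv_eq_deriv_mul hφac
    rw [hφ0, hφr, mul_zero, mul_zero, sub_zero, zero_sub] at key
    rw [← integral_Ioc_eq_integral_Ioo, ← integral_Ioc_eq_integral_Ioo,
      ← intervalIntegral.integral_of_le hr.le, ← intervalIntegral.integral_of_le hr.le]
    simp only [fderiv_apply_one_eq_deriv]
    rw [key]
    congr 1
    refine intervalIntegral.integral_congr_ae ?_
    filter_upwards [hderiv] with t ht htr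
    rw [ht (uIoc_subset_uIcc htr)]

/-- Functions on an interval with a weak derivative are primitives of this derivative. -/
theorem MemH.eq_add_integral {h : ℝ} (hh : 0 < h) {v w : ℝ → ℝ} (hvw : MemH 1 (Ioo 0 h) v w)
    (hv : ContinuousOn v (Icc 0 h)) {t : ℝ} (ht : t ∈ Icc 0 h) :
    v t = v 0 + ∫ τ in (0 : ℝ)..t, w τ := by
  have hfin : volume (Ioo 0 h) ≠ ⊤ := by simp
  obtain ⟨v₀, hv₀m, hv₀i, hv₀K, hv₀⟩ :=
    exists_measurable_representative measurableSet_Ioo hfin hvw.memLp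
  obtain ⟨w₀, hw₀m, hw₀i, hw₀K, hw₀⟩ :=
    exists_measurable_representative measurableSet_Ioo hfin hvw.memLp_deriv
  have hae := ae_ae_increment_eq isOpen_Ioo hv₀m hv₀i hw₀m hw₀i hv₀K hw₀K
    (hasWeakDirDeriv_congr hvw.hasWeakDirDeriv hv₀ hw₀)
  -- Almost every point can serve as base point, and the interval has positive measure, so one
  -- exists.
  have hpos : volume (Ioo 0 h) ≠ 0 := by simp [hh]
  obtain ⟨t₀, ht₀, hbase⟩ : ∃ t₀ ∈ Ioo 0 h, ∀ᵐ k : ℝ, t₀ ∈ segmentDomain 1 (Ioo 0 h) k →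
      v₀ (t₀ + k • 1) - v₀ t₀ - k * ∫ θ in (0 : ℝ)..1, w₀ (t₀ + (θ * k) • 1) = 0 := by
    by_contra hcon
    exact hpos (measure_mono_null (fun t ht hP => hcon ⟨t, ht, hP⟩) hae)
  have hline := ae_eq_add_integral_of_base (K := Ioo 0 h) (d := (1 : ℝ)) (s := 0) ht₀
    (fun t ht => by simpa using ht) (by simpa using hbase)
  simp only [smul_eq_mul, mul_one, zero_add] at hline
  have hw₀L : MemLp w₀ 2 (volume.restrict (Ioo 0 h)) := (memLp_congr_ae hw₀).1 hvw.memLp_deriv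
  have hcont := continuousOn_primitive hh hw₀L (Ioo_subset_Icc_self ht₀) (v₀ t₀)
  have heq : EqOn v (fun t => v₀ t₀ + ∫ τ in t₀..t, w₀ τ) (Icc 0 h) := by
    refine eqOn_Icc_of_ae_eq volume hh.ne ?_ hv hcont
    rw [← restrict_congr_set Ioo_ae_eq_Icc]
    exact hv₀.trans hline
  have h0 : (0 : ℝ) ∈ Icc 0 h := left_mem_Icc.2 hh.le
  have hint : ∫ τ in (0 : ℝ)..t, w τ = ∫ τ in (0 : ℝ)..t, w₀ τ := by
    refine intervalIntegral.integral_congr_ae_restrict ?_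
    rw [uIoc_of_le ht.1, ← restrict_congr_set (Ioo_ae_eq_Ioc (μ := (volume : Measure ℝ)))]
    exact ae_restrict_of_ae_restrict_of_subset (Ioo_subset_Ioo_right ht.2) hw₀
  have hadd := intervalIntegral.integral_add_adjacent_intervals
    (intervalIntegrable_of_memLp hw₀L (Ioo_subset_Icc_self ht₀) h0)
    (intervalIntegrable_of_memLp hw₀L h0 ht)
  rw [heq ht, heq h0, hint]
  simp only
  linarith

/-- Cauchy–Schwarz on `(0, t)`, obtained from the nonnegativity of the variance of `w` about its
mean `I / t`. -/
theorem sq_intervalIntegral_le {h : ℝ} {w : ℝ → ℝ}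
    (hw : MemLp w 2 (volume.restrict (Ioo 0 h))) {t : ℝ} (ht : t ∈ Icc 0 h) :
    (∫ τ in (0 : ℝ)..t, w τ) ^ 2 ≤ h * ∫ τ in Ioo 0 h, w τ ^ 2 := by
  have hh : 0 ≤ h := ht.1.trans ht.2
  have hA : 0 ≤ ∫ τ in Ioo 0 h, w τ ^ 2 := integral_nonneg fun τ => sq_nonneg _
  rcases ht.1.eq_or_lt with h0 | h0
  · rw [← h0]
    simpa using mul_nonneg hh hA
  set I := ∫ τ in (0 : ℝ)..t, w τ with hI
  have hwt : MemLp w 2 (volume.restrict (Ioo 0 t)) :=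
    hw.mono_measure (restrict_mono (Ioo_subset_Ioo_right ht.2) le_rfl)
  have hsq : Integrable (fun τ => w τ ^ 2) (volume.restrict (Ioo 0 t)) := hwt.integrable_sq
  have hwi : Integrable w (volume.restrict (Ioo 0 t)) := hwt.integrable (by norm_num)
  have hIe : I = ∫ τ in Ioo 0 t, w τ := by
    rw [hI, intervalIntegral.integral_of_le ht.1, integral_Ioc_eq_integral_Ioo]
  have hmono : ∫ τ in Ioo 0 t, w τ ^ 2 ≤ ∫ τ in Ioo 0 h, w τ ^ 2 :=
    setIntegral_mono_set hw.integrable_sq (Eventually.of_forall fun τ => sq_nonneg _)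
      (Ioo_subset_Ioo_right ht.2).eventuallyLE
  have hexp : ∫ τ in Ioo 0 t, (w τ - I / t) ^ 2
      = (∫ τ in Ioo 0 t, w τ ^ 2) - I ^ 2 / t := by
    have h1 : ∀ τ, (w τ - I / t) ^ 2 = w τ ^ 2 - (2 * (I / t)) * w τ + (I / t) ^ 2 := fun τ => by
      ring
    simp only [h1]
    have i2 : Integrable (fun τ => (2 * (I / t)) * w τ) (volume.restrict (Ioo 0 t)) :=
      hwi.const_mul _
    have i3 : Integrable (fun τ => w τ ^ 2 - (2 * (I / t)) * w τ) (volume.restrict (Ioo 0 t)) :=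
      hsq.sub i2
    rw [integral_add i3 (integrable_const _), integral_sub hsq i2, integral_const_mul, ← hIe,
      integral_const]
    simp only [measureReal_restrict_apply_univ, Real.volume_real_Ioo_of_le ht.1, sub_zero,
      smul_eq_mul]
    field_simp
    ring
  have hnn : 0 ≤ ∫ τ in Ioo 0 t, (w τ - I / t) ^ 2 := integral_nonneg fun τ => sq_nonneg _
  rw [hexp, sub_nonneg, div_le_iff₀ h0] at hnn
  calc I ^ 2 ≤ (∫ τ in Ioo 0 t, w τ ^ 2) * t := hnn
    _ ≤ (∫ τ in Ioo 0 h, w τ ^ 2) * h := mul_le_mul hmono ht.2 ht.1 hA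
    _ = _ := mul_comm _ _

theorem intervalEquiv_third_three : IntervalEquiv (1 / 3) 3 := by
  refine ⟨by norm_num, by norm_num, fun h k hh hk v w hvw hv => ?_⟩
  set A := ∫ x in Ioo 0 h, w x ^ 2 with hA
  set B := ∫ x in Ioo 0 h, v x ^ 2 with hB
  have hA0 : 0 ≤ A := integral_nonneg fun x => sq_nonneg _
  -- From `v t = v 0 + I` with `I² ≤ h A`. The two differences of squares are `(v 0 - I)²` and `(v 0
  -- + 2 I)²`.
  have hpt : ∀ t ∈ Ioo 0 h, v t ^ 2 ≤ 2 * v 0 ^ 2 + 2 * (h * A) ∧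
      v 0 ^ 2 ≤ 2 * v t ^ 2 + 2 * (h * A) := by
    intro t ht
    have h1 := hvw.eq_add_integral hh hv (Ioo_subset_Icc_self ht)
    have h2 := sq_intervalIntegral_le hvw.memLp_deriv (Ioo_subset_Icc_self ht)
    set I := ∫ τ in (0 : ℝ)..t, w τ
    rw [h1]
    constructor
    · nlinarith [sq_nonneg (v 0 - I)]
    · nlinarith [sq_nonneg (v 0 + 2 * I)]
  have hvsq : Integrable (fun t => v t ^ 2) (volume.restrict (Ioo 0 h)) := hvw.memLp.integrable_sq
  have hconst : ∀ c : ℝ, ∫ _ in Ioo 0 h, c = h * c := fun c => by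
    rw [integral_const]
    simp [Real.volume_real_Ioo_of_le hh.le]
  have hB1 : B ≤ h * (2 * v 0 ^ 2 + 2 * (h * A)) := by
    rw [← hconst]
    exact setIntegral_mono_on hvsq (integrable_const _) measurableSet_Ioo fun t ht => (hpt t ht).1
  have hB2 : h * v 0 ^ 2 ≤ 2 * B + h * (2 * (h * A)) := by
    rw [← hconst, ← hconst, hB, ← integral_const_mul, ← integral_add (hvsq.const_mul 2)
      (integrable_const _)]
    exact setIntegral_mono_on (integrable_const _)
      ((hvsq.const_mul 2).add (integrable_const _)) measurableSet_Ioo fun t ht => (hpt t ht).2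
  have hkA : h ^ 2 * A ≤ k ^ 2 * A :=
    mul_le_mul_of_nonneg_right (pow_le_pow_left₀ hh.le hk 2) hA0
  have hv0 : 0 ≤ h * v 0 ^ 2 := by positivity
  have hB0 : 0 ≤ B := integral_nonneg fun x => sq_nonneg _
  -- With `h ≤ k` the integrated bounds read `B ≤ 2 h v(0)² + 2 k² A` and `h v(0)² ≤ 2 B + 2 k² A`.
  -- Adding `k² A` gives the factor `3` in both directions.
  constructor
  · nlinarith
  · nlinarith

end Interval

/-! ### Consequences of the disintegration along characteristics. -/

noncomputable section Decomposition

open Measure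
open scoped NNReal ENNReal RealInnerProductSpace

variable {E : Type*} [NormedAddCommGroup E] [InnerProductSpace ℝ E]
  [FiniteDimensional ℝ E] [MeasurableSpace E] [BorelSpace E]
  {d : E} {K : Set E} {μ : Measure E} {κ r : E → ℝ}

/-- The characteristics with direction `d` entering `K` at `s` have length `r s` for `μ`-almost
every `s`, and Lebesgue measure on `K` disintegrates along them with density `κ`. -/
structure IsCharDecomposition (d : E) (K : Set E) (μ : Measure E) (κ r : E → ℝ) : Prop where
  pos : ∀ᵐ s ∂μ, 0 < r s ∧ 0 < κ s ∧ {t | (s, t) ∈ charDomain d K} = Ioo 0 (r s)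
  aemeasurable_weight : AEMeasurable κ μ
  lintegral_eq : ∀ F : E → ℝ≥0∞, Measurable F →
    ∫⁻ x in K, F x = ∫⁻ s, ENNReal.ofReal (κ s) * charIntegral d K F s ∂μ

namespace IsCharDecomposition

theorem mem_of_section_eq {s : E} {ρ : ℝ} (h : {t | (s, t) ∈ charDomain d K} = Ioo 0 ρ) {t : ℝ}
    (ht : t ∈ Ioo 0 ρ) : s + t • d ∈ K := by
  rw [← h] at ht
  exact ht.2 t ⟨ht.1, le_rfl⟩

theorem aemeasurable_mul_charIntegral (hD : IsCharDecomposition d K μ κ r) (hK : IsOpen K)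
    {F : E → ℝ≥0∞} (hF : Measurable F) :
    AEMeasurable (fun s => ENNReal.ofReal (κ s) * charIntegral d K F s) μ :=
  hD.aemeasurable_weight.ennreal_ofReal.mul (measurable_charIntegral hK hF).aemeasurable

/-- The disintegration of the indicator of a measurable null hull vanishes; since `κ` is positive,
almost every characteristic meets the hull in a null set. -/
theorem ae_ae (hD : IsCharDecomposition d K μ κ r) (hK : IsOpen K) {p : E → Prop}
    (hp : ∀ᵐ x ∂(volume.restrict K), p x) :
    ∀ᵐ s ∂μ, ∀ᵐ t ∂(volume.restrict (Ioo 0 (r s))), p (s + t • d) := by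
  set N := toMeasurable (volume.restrict K) {x | ¬ p x} with hN
  have hNm : MeasurableSet N := measurableSet_toMeasurable _ _
  have hF : Measurable (N.indicator (1 : E → ℝ≥0∞)) := measurable_one.indicator hNm
  have h0 : ∫⁻ x in K, N.indicator (1 : E → ℝ≥0∞) x = 0 := by
    rw [lintegral_indicator_one hNm, hN, measure_toMeasurable]
    exact hp
  rw [hD.lintegral_eq _ hF,
    lintegral_eq_zero_iff' (hD.aemeasurable_mul_charIntegral hK hF)] at h0
  filter_upwards [h0, hD.pos] with s hs ⟨_, hκ, hsec⟩
  have hs0 : charIntegral d K (N.indicator (1 : E → ℝ≥0∞)) s = 0 :=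
    (mul_eq_zero.1 hs).resolve_left (ENNReal.ofReal_pos.2 hκ).ne'
  have hFs : Measurable fun t : ℝ => N.indicator (1 : E → ℝ≥0∞) (s + t • d) :=
    hF.comp (Continuous.measurable (by fun_prop))
  rw [charIntegral, hsec, lintegral_eq_zero_iff hFs] at hs0
  filter_upwards [hs0] with t ht
  by_contra hpt
  have hmem : s + t • d ∈ N := subset_toMeasurable _ _ hpt
  simp [hmem] at ht

theorem aemeasurable_length (hD : IsCharDecomposition d K μ κ r) (hK : IsOpen K) :
    AEMeasurable r μ := by
  -- The length is the integral of `1` over the characteristic, which avoids any measurability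
  -- argument for the infimum defining `charLength`.
  refine ((measurable_charIntegral (d := d) hK
    (measurable_one : Measurable (1 : E → ℝ≥0∞))).ennreal_toReal.aemeasurable).congr ?_
  filter_upwards [hD.pos] with s ⟨hr, _, hsec⟩
  simp [charIntegral, hsec, hr.le]

/-- Fubini along the characteristics. -/
theorem integrable_integral (hD : IsCharDecomposition d K μ κ r) (hK : IsOpen K) {F : E → ℝ}
    (hFm : Measurable F) (hF0 : ∀ x, 0 ≤ F x) (hF : IntegrableOn F K) :
    (∀ᵐ s ∂μ, IntegrableOn (fun t => F (s + t • d)) (Ioo 0 (r s))) ∧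
    Integrable (fun s => κ s * ∫ t in Ioo 0 (r s), F (s + t • d)) μ ∧
    ∫ s, κ s * (∫ t in Ioo 0 (r s), F (s + t • d)) ∂μ = ∫ x in K, F x := by
  set G : E → ℝ≥0∞ := fun x => ENNReal.ofReal (F x) with hG
  have hGm : Measurable G := hFm.ennreal_ofReal
  have hline : ∀ s : E, Measurable fun t : ℝ => F (s + t • d) := fun s =>
    hFm.comp (Continuous.measurable (by fun_prop))
  have hKG : ∫⁻ x in K, G x = ENNReal.ofReal (∫ x in K, F x) :=
    (ofReal_integral_eq_lintegral_ofReal hF (Eventually.of_forall hF0)).symm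
  have heq := hD.lintegral_eq G hGm
  have hHm := hD.aemeasurable_mul_charIntegral hK hGm
  set H : E → ℝ≥0∞ := fun s => ENNReal.ofReal (κ s) * charIntegral d K G s with hH
  have hfin : ∫⁻ s, H s ∂μ ≠ ⊤ := by
    rw [← heq, hKG]
    exact ENNReal.ofReal_ne_top
  have hHae : ∀ᵐ s ∂μ, (H s).toReal = κ s * ∫ t in Ioo 0 (r s), F (s + t • d) := by
    filter_upwards [hD.pos] with s ⟨_, hκ, hsec⟩
    rw [hH, ENNReal.toReal_mul, ENNReal.toReal_ofReal hκ.le, charIntegral, hsec,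
      integral_eq_lintegral_of_nonneg_ae (Eventually.of_forall fun t => hF0 _)
        (hline s).aestronglyMeasurable]
  refine ⟨?_, (integrable_toReal_of_lintegral_ne_top hHm hfin).congr hHae, ?_⟩
  · filter_upwards [hD.pos, ae_lt_top' hHm hfin] with s ⟨_, hκ, hsec⟩ hlt
    have hc : charIntegral d K G s ≠ ⊤ := fun hc => by
      simp only [hH] at hlt
      rw [hc, ENNReal.mul_top (ENNReal.ofReal_pos.2 hκ).ne'] at hlt
      exact lt_irrefl _ hlt
    rw [charIntegral, hsec] at hc
    exact (lintegral_ofReal_ne_top_iff_integrable (hline s).aestronglyMeasurable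
      (Eventually.of_forall fun t => hF0 _)).1 hc
  · rw [← integral_congr_ae hHae, integral_toReal hHm (ae_lt_top' hHm hfin), ← heq, hKG,
      ENNReal.toReal_ofReal (integral_nonneg hF0)]

end IsCharDecomposition

theorem tendsto_average_of_continuousWithinAt {f : ℝ → ℝ} {ρ : ℝ} (hρ : 0 < ρ)
    (hf : ContinuousOn f (Icc 0 ρ)) :
    Tendsto (fun k : ℕ => ((k : ℝ) + 1) * ∫ t in Ioo 0 (1 / ((k : ℝ) + 1)), f t) atTop
      (𝓝 (f 0)) := by
  have hc : ContinuousWithinAt f (Ioi 0) 0 :=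
    (hf 0 (left_mem_Icc.2 hρ.le)).mono_of_mem_nhdsWithin (Icc_mem_nhdsGT hρ)
  have hm : StronglyMeasurableAtFilter f (𝓝[>] 0) :=
    ⟨Ioo 0 ρ, Ioo_mem_nhdsGT hρ, (hf.mono Ioo_subset_Icc_self).aestronglyMeasurable
      measurableSet_Ioo⟩
  have hder : HasDerivWithinAt (fun u => ∫ t in (0 : ℝ)..u, f t) (f 0) (Ici 0) 0 :=
    intervalIntegral.integral_hasDerivWithinAt_right (by simp) hm hc
  have hslope := hasDerivWithinAt_iff_tendsto_slope.1 hder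
  have hseq : Tendsto (fun k : ℕ => 1 / ((k : ℝ) + 1)) atTop (𝓝[Ici 0 \ {0}] 0) := by
    refine tendsto_nhdsWithin_iff.2 ⟨tendsto_one_div_add_atTop_nhds_zero_nat,
      Eventually.of_forall fun k => ?_⟩
    have : (0 : ℝ) < 1 / ((k : ℝ) + 1) := by positivity
    exact ⟨this.le, this.ne'⟩
  refine (hslope.comp hseq).congr fun k => ?_
  have : (0 : ℝ) < 1 / ((k : ℝ) + 1) := by positivity
  simp only [Function.comp_apply, slope_def_field, intervalIntegral.integral_same, sub_zero,
    intervalIntegral.integral_of_le this.le, integral_Ioc_eq_integral_Ioo]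
  field_simp

/-- Values at the entry points of functions that are continuous along the characteristics depend
measurably on the entry point. -/
theorem IsCharDecomposition.aemeasurable_trace (hD : IsCharDecomposition d K μ κ r)
    (hK : IsOpen K) {v : E → ℝ} (hv : Measurable v) {g : E → ℝ}
    (hg : ∀ᵐ s ∂μ, ∃ f : ℝ → ℝ, ContinuousOn f (Icc 0 (r s)) ∧
      (∀ᵐ t ∂(volume.restrict (Ioo 0 (r s))), v (s + t • d) = f t) ∧ f 0 = g s) :
    AEMeasurable g μ := by
  -- The trace is the limit of averages of `v` over the initial pieces of length `1 / (k + 1)`.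
  -- Cutting `charDomain`, instead of using `r`, makes these averages measurable in `s`.
  let A : ℕ → Set (E × ℝ) := fun k => charDomain d K ∩ {p | p.2 < 1 / ((k : ℝ) + 1)}
  have hA : ∀ k, MeasurableSet (A k) := fun k =>
    (measurableSet_charDomain d hK).inter (measurableSet_lt measurable_snd measurable_const)
  let V : E × ℝ → ℝ := fun p => v (p.1 + p.2 • d)
  have hV : Measurable V := hv.comp (Continuous.measurable (by fun_prop))
  have hm : ∀ k : ℕ, Measurable fun s : E => ((k : ℝ) + 1) * ∫ t, (A k).indicator V (s, t) :=
    fun k => ((hV.indicator (hA k)).stronglyMeasurable.integral_prod_right').measurable.const_mul _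
  refine aemeasurable_of_tendsto_metrizable_ae atTop (fun k => (hm k).aemeasurable) ?_
  filter_upwards [hg, hD.pos] with s ⟨f, hf, hvf, hfg⟩ ⟨hr, _, hsec⟩
  rw [← hfg]
  refine (tendsto_average_of_continuousWithinAt hr hf).congr' ?_
  filter_upwards [tendsto_one_div_add_atTop_nhds_zero_nat.eventually (gt_mem_nhds hr)] with k hk
  congr 1
  have h1 : (fun t => (A k).indicator V (s, t))
      = (Ioo 0 (1 / ((k : ℝ) + 1))).indicator fun t => v (s + t • d) := by
    ext t
    have hmem : (s, t) ∈ A k ↔ t ∈ Ioo 0 (1 / ((k : ℝ) + 1)) := by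
      have h2 : (s, t) ∈ charDomain d K ↔ t ∈ Ioo 0 (r s) := by rw [← hsec]; rfl
      constructor
      · exact fun h => ⟨(h2.1 h.1).1, h.2⟩
      · exact fun h => ⟨h2.2 ⟨h.1, h.2.trans hk⟩, h.2⟩
    by_cases ht : t ∈ Ioo 0 (1 / ((k : ℝ) + 1))
    · rw [indicator_of_mem ht, indicator_of_mem (hmem.2 ht)]
    · rw [indicator_of_notMem ht, indicator_of_notMem (mt hmem.1 ht)]
  rw [h1, integral_indicator measurableSet_Ioo]
  refine integral_congr_ae ?_
  exact (ae_restrict_of_ae_restrict_of_subset (Ioo_subset_Ioo_right hk.le) hvf).mono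
    fun t ht => ht.symm

/-- Along almost every characteristic, a function with a square-integrable derivative in direction
`d` is a primitive of this derivative. -/
theorem IsCharDecomposition.ae_primitive (hD : IsCharDecomposition d K μ κ r) (hK : IsOpen K)
    {v w : E → ℝ} (hv : Measurable v) (hvi : Integrable v) (hw : Measurable w)
    (hwi : Integrable w) (hv0 : ∀ x, x ∉ K → v x = 0) (hw0 : ∀ x, x ∉ K → w x = 0)
    (hweak : HasWeakDirDeriv d K v w) (hw2 : MemLp w 2 (volume.restrict K)) :
    ∀ᵐ s ∂μ, MemLp (fun t => w (s + t • d)) 2 (volume.restrict (Ioo 0 (r s))) ∧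
      ∃ f : ℝ → ℝ, ContinuousOn f (Icc 0 (r s)) ∧
        MemH 1 (Ioo 0 (r s)) f (fun t => w (s + t • d)) ∧
        ∀ᵐ t ∂(volume.restrict (Ioo 0 (r s))), v (s + t • d) = f t := by
  have hbase := hD.ae_ae hK (ae_restrict_of_ae
    (ae_ae_increment_eq hK hv hvi hw hwi hv0 hw0 hweak))
  have hsq := (hD.integrable_integral hK (hw.pow_const 2) (fun x => sq_nonneg (w x))
    hw2.integrable_sq).1
  filter_upwards [hbase, hsq, hD.pos] with s hs hsq ⟨hr, _, hsec⟩
  have hwL : MemLp (fun t => w (s + t • d)) 2 (volume.restrict (Ioo 0 (r s))) :=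
    (memLp_two_iff_integrable_sq
      (hw.comp (Continuous.measurable (by fun_prop))).aestronglyMeasurable).2 hsq
  obtain ⟨t₀, ht₀, hb⟩ : ∃ t₀ ∈ Ioo 0 (r s), ∀ᵐ h : ℝ, s + t₀ • d ∈ segmentDomain d K h →
      v (s + t₀ • d + h • d) - v (s + t₀ • d)
        - h * ∫ θ in (0 : ℝ)..1, w (s + t₀ • d + (θ * h) • d) = 0 := by
    have hne : volume.restrict (Ioo 0 (r s)) ≠ 0 := by
      rw [Ne, restrict_eq_zero]
      simp [hr]
    have := ae_neBot.2 hne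
    obtain ⟨t, ht, htm⟩ := (hs.and (ae_restrict_mem measurableSet_Ioo)).exists
    exact ⟨t, htm, ht⟩
  have ht₀' := Ioo_subset_Icc_self ht₀
  exact ⟨hwL, _, continuousOn_primitive hr hwL ht₀' _, memH_primitive hr hwL ht₀' _,
    ae_eq_add_integral_of_base ht₀ (fun t ht => IsCharDecomposition.mem_of_section_eq hsec ht) hb⟩

end Decomposition

/-! ### The trace and the equivalence of norms. -/

noncomputable section Trace

open Measure Module
open scoped NNReal ENNReal RealInnerProductSpace

variable {E : Type*} [NormedAddCommGroup E] [InnerProductSpace ℝ E]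
  [FiniteDimensional ℝ E] [MeasurableSpace E] [BorelSpace E]
  {d : E} {K : Set E} {μ : Measure E} {κ r : E → ℝ}

/-- `g` gives the initial values of the continuous representatives of `v` along the segments with
direction `d` and length `r s` that start at `s`. -/
def IsCharTrace (d : E) (μ : Measure E) (r v g : E → ℝ) : Prop :=
  ∀ᵐ s ∂μ, ∃ f : ℝ → ℝ, ContinuousOn f (Icc 0 (r s)) ∧
    (∀ᵐ t ∂(volume.restrict (Ioo 0 (r s))), v (s + t • d) = f t) ∧ f 0 = g s

/-- Existence of the trace, and the equivalence of the norms defined by the trace and by the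
function itself, for any pair of constants that is admissible in one dimension. -/
theorem IsCharDecomposition.trace_equiv (hD : IsCharDecomposition d K μ κ r) (hK : IsOpen K)
    (hfin : volume K ≠ ⊤) {c C k : ℝ} (hcC : IntervalEquiv c C) (hk : ∀ᵐ s ∂μ, r s ≤ k)
    {v w : E → ℝ} (hvw : MemH d K v w) :
    (∃ g, IsCharTrace d μ r v g) ∧ ∀ g, IsCharTrace d μ r v g →
      Integrable (fun s => g s ^ 2 * (κ s * r s)) μ ∧
      c * (k ^ 2 * (∫ x in K, w x ^ 2) + ∫ x in K, v x ^ 2)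
        ≤ k ^ 2 * (∫ x in K, w x ^ 2) + ∫ s, g s ^ 2 * (κ s * r s) ∂μ ∧
      k ^ 2 * (∫ x in K, w x ^ 2) + ∫ s, g s ^ 2 * (κ s * r s) ∂μ
        ≤ C * (k ^ 2 * (∫ x in K, w x ^ 2) + ∫ x in K, v x ^ 2) := by
  obtain ⟨v₀, hv₀m, hv₀i, hv₀K, hv₀⟩ :=
    exists_measurable_representative hK.measurableSet hfin hvw.memLp
  obtain ⟨w₀, hw₀m, hw₀i, hw₀K, hw₀⟩ :=
    exists_measurable_representative hK.measurableSet hfin hvw.memLp_deriv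
  have hv₀L : MemLp v₀ 2 (volume.restrict K) := (memLp_congr_ae hv₀).1 hvw.memLp
  have hw₀L : MemLp w₀ 2 (volume.restrict K) := (memLp_congr_ae hw₀).1 hvw.memLp_deriv
  have hprim := hD.ae_primitive hK hv₀m hv₀i hw₀m hw₀i hv₀K hw₀K
    (hasWeakDirDeriv_congr hvw.hasWeakDirDeriv hv₀ hw₀) hw₀L
  have hline := hD.ae_ae hK hv₀
  constructor
  · classical
    let P : E → (ℝ → ℝ) → Prop := fun s f => ContinuousOn f (Icc 0 (r s)) ∧
      ∀ᵐ t ∂(volume.restrict (Ioo 0 (r s))), v (s + t • d) = f t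
    refine ⟨fun s => if h : ∃ f, P s f then h.choose 0 else 0, ?_⟩
    filter_upwards [hprim, hline] with s ⟨_, f, hf, _, hvf⟩ hl
    have h : ∃ f, P s f := ⟨f, hf, by filter_upwards [hvf, hl] with t h1 h2 using h2.trans h1⟩
    exact ⟨h.choose, h.choose_spec.1, h.choose_spec.2, by rw [dif_pos h]⟩
  intro g hg
  have hg₀ : IsCharTrace d μ r v₀ g := by
    filter_upwards [hg, hline] with s ⟨f, hf, hvf, hfg⟩ hl
    exact ⟨f, hf, by filter_upwards [hvf, hl] with t h1 h2 using h2.symm.trans h1, hfg⟩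
  have hgm : AEMeasurable g μ := hD.aemeasurable_trace hK hv₀m hg₀
  have hrm := hD.aemeasurable_length hK
  obtain ⟨-, hVi, hVe⟩ := hD.integrable_integral hK (hv₀m.pow_const 2)
    (fun x => sq_nonneg (v₀ x)) hv₀L.integrable_sq
  obtain ⟨-, hWi, hWe⟩ := hD.integrable_integral hK (hw₀m.pow_const 2)
    (fun x => sq_nonneg (w₀ x)) hw₀L.integrable_sq
  have ev : ∫ x in K, v x ^ 2 = ∫ x in K, v₀ x ^ 2 :=
    integral_congr_ae (hv₀.mono fun x hx => by simp only [hx])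
  have ew : ∫ x in K, w x ^ 2 = ∫ x in K, w₀ x ^ 2 :=
    integral_congr_ae (hw₀.mono fun x hx => by simp only [hx])
  rw [ev, ew, ← hVe, ← hWe]
  set V : E → ℝ := fun s => κ s * ∫ t in Ioo 0 (r s), v₀ (s + t • d) ^ 2 with hV
  set W : E → ℝ := fun s => κ s * ∫ t in Ioo 0 (r s), w₀ (s + t • d) ^ 2 with hW
  have hpt : ∀ᵐ s ∂μ, 0 ≤ W s ∧ 0 ≤ g s ^ 2 * (κ s * r s) ∧
      c * (k ^ 2 * W s + V s) ≤ k ^ 2 * W s + g s ^ 2 * (κ s * r s) ∧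
      k ^ 2 * W s + g s ^ 2 * (κ s * r s) ≤ C * (k ^ 2 * W s + V s) := by
    filter_upwards [hD.pos, hg₀, hprim, hk] with s ⟨hr, hκ, _⟩ ⟨f₁, hf₁, hvf₁, hfg⟩
      ⟨_, f, hf, hH, hvf⟩ hrk
    -- Continuous functions that agree almost everywhere on an interval agree everywhere, so any
    -- admissible `g` takes the value at `0` of the primitive.
    have heq : EqOn f₁ f (Icc 0 (r s)) := by
      refine eqOn_Icc_of_ae_eq volume hr.ne ?_ hf₁ hf
      rw [← restrict_congr_set Ioo_ae_eq_Icc]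
      filter_upwards [hvf₁, hvf] with t h1 h2 using h1.symm.trans h2
    have hf0 : f 0 = g s := by rw [← hfg, heq (left_mem_Icc.2 hr.le)]
    have hfv : ∫ t in Ioo 0 (r s), f t ^ 2 = ∫ t in Ioo 0 (r s), v₀ (s + t • d) ^ 2 :=
      integral_congr_ae (hvf.mono fun t ht => by simp only [ht])
    -- The one-dimensional equivalence on a single characteristic; multiplication by `κ s` prepares
    -- it for integration over `s`.
    obtain ⟨h1, h2⟩ := hcC.2.2 (r s) k hr hrk f _ hH hf
    rw [hf0, hfv] at h1 h2
    have h3 := mul_le_mul_of_nonneg_left h1 hκ.le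
    have h4 := mul_le_mul_of_nonneg_left h2 hκ.le
    refine ⟨mul_nonneg hκ.le (integral_nonneg fun t => sq_nonneg _),
      mul_nonneg (sq_nonneg _) (mul_nonneg hκ.le hr.le), ?_, ?_⟩
    · simp only [hV, hW]
      linarith
    · simp only [hV, hW]
      linarith
  have hUi : Integrable (fun s => k ^ 2 * W s + V s) μ := (hWi.const_mul _).add hVi
  have hGi : Integrable (fun s => g s ^ 2 * (κ s * r s)) μ := by
    -- The pointwise upper bound, after dropping `k² W ≥ 0`, is an integrable majorant.
    refine (hUi.const_mul C).mono'
      ((hgm.pow_const 2).mul (hD.aemeasurable_weight.mul hrm)).aestronglyMeasurable ?_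
    filter_upwards [hpt] with s ⟨h1, h2, _, h4⟩
    rw [Real.norm_of_nonneg h2]
    linarith [mul_nonneg (sq_nonneg k) h1]
  have hLi : Integrable (fun s => k ^ 2 * W s + g s ^ 2 * (κ s * r s)) μ :=
    (hWi.const_mul _).add hGi
  have e1 : ∫ s, c * (k ^ 2 * W s + V s) ∂μ = c * (k ^ 2 * (∫ s, W s ∂μ) + ∫ s, V s ∂μ) := by
    rw [integral_const_mul, integral_add (hWi.const_mul _) hVi, integral_const_mul]
  have e2 : ∫ s, C * (k ^ 2 * W s + V s) ∂μ = C * (k ^ 2 * (∫ s, W s ∂μ) + ∫ s, V s ∂μ) := by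
    rw [integral_const_mul, integral_add (hWi.const_mul _) hVi, integral_const_mul]
  have e3 : ∫ s, k ^ 2 * W s + g s ^ 2 * (κ s * r s) ∂μ
      = k ^ 2 * (∫ s, W s ∂μ) + ∫ s, g s ^ 2 * (κ s * r s) ∂μ := by
    rw [integral_add (hWi.const_mul _) hGi, integral_const_mul]
  refine ⟨hGi, ?_, ?_⟩
  · rw [← e1, ← e3]
    exact integral_mono_ae (hUi.const_mul c) hLi (hpt.mono fun s hs => hs.2.2.1)
  · rw [← e2, ← e3]
    exact integral_mono_ae hLi (hUi.const_mul C) (hpt.mono fun s hs => hs.2.2.2)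

theorem inflow_direction {b : E} (hb : b ≠ 0) (K : Set E) :
    inflow (direction b) K = inflow b K := by
  have hb0 : 0 < ‖b‖⁻¹ := inv_pos.2 (norm_pos_iff.2 hb)
  ext s
  simp only [inflow, direction, mem_ofPred_eq, real_inner_smul_left]
  exact and_congr_right fun _ => ⟨fun h => by by_contra hn; push Not at hn; nlinarith,
    fun h => mul_neg_of_pos_of_neg hb0 h⟩

theorem IsLipschitzDomain.isCharDecomposition {m : ℕ} (hrank : finrank ℝ E = m + 1) {b : E}
    (hb : b ≠ 0) (hK : IsLipschitzDomain K) :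
    IsCharDecomposition (direction b) K ((μHE[m] : Measure E).restrict (inflow b K))
      (fun s => |⟪direction b, outerNormal K s⟫|) (charLength b K) := by
  obtain ⟨h1, h2, h3⟩ := hK.exists_characteristic_decomposition hrank hb
  rw [inflow_direction hb] at h1 h2
  simp only [inflow_direction hb] at h3
  exact ⟨h1.mono fun s hs => ⟨hs.1, hs.2.2.2, Set.ext hs.2.2.1⟩, h2, h3⟩

theorem MemH.direction {b : E} {v w : E → ℝ} (h : MemH b K v w) :
    MemH (direction b) K v (fun x => ‖b‖⁻¹ * w x) := by
  refine ⟨h.memLp, h.memLp_deriv.const_mul _, fun φ hφ hφc hφs => ?_⟩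
  have e1 : ∀ x, v x * fderiv ℝ φ x (Transport.direction b)
      = ‖b‖⁻¹ * (v x * fderiv ℝ φ x b) := fun x => by
    rw [Transport.direction, map_smul, smul_eq_mul]; ring
  have e2 : ∀ x, ‖b‖⁻¹ * w x * φ x = ‖b‖⁻¹ * (w x * φ x) := fun x => mul_assoc _ _ _
  simp only [e1, e2]
  rw [integral_const_mul, integral_const_mul, h.hasWeakDirDeriv φ hφ hφc hφs, mul_neg]

end Trace

end Transport

/-! ### The main theorem. -/

open Transport in
theorem proposition4 :
    (∃ c C : ℝ, IntervalEquiv c C) ∧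
    ∀ c C : ℝ, IntervalEquiv c C →
      ∀ (n : ℕ) (K : Set (EuclideanSpace ℝ (Fin n))) (b : EuclideanSpace ℝ (Fin n)) (q : ℝ),
        IsLipschitzDomain K → b ≠ 0 → ‖b‖⁻¹ * Metric.diam K ≤ q →
        ∀ v w : EuclideanSpace ℝ (Fin n) → ℝ, MemH b K v w →
          (∃ g : EuclideanSpace ℝ (Fin n) → ℝ, IsInflowTrace b K v g) ∧
          ∀ g : EuclideanSpace ℝ (Fin n) → ℝ, IsInflowTrace b K v g →
            Integrable (fun s => g s ^ 2 * inflowWeight b K s) (inflowMeasure b K) ∧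
            c * (q ^ 2 * (∫ x in K, w x ^ 2) + ∫ x in K, v x ^ 2)
              ≤ q ^ 2 * (∫ x in K, w x ^ 2)
                + ∫ s, g s ^ 2 * inflowWeight b K s ∂(inflowMeasure b K) ∧
            q ^ 2 * (∫ x in K, w x ^ 2)
                + ∫ s, g s ^ 2 * inflowWeight b K s ∂(inflowMeasure b K)
              ≤ C * (q ^ 2 * (∫ x in K, w x ^ 2) + ∫ x in K, v x ^ 2) := by
  refine ⟨⟨1 / 3, 3, intervalEquiv_third_three⟩, ?_⟩
  intro c C hcC n K b q hK hb hq v w hvw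
  obtain _ | m := n
  · exact absurd (Subsingleton.elim b 0) hb
  have hb0 : 0 < ‖b‖ := norm_pos_iff.2 hb
  have hrank : Module.finrank ℝ (EuclideanSpace ℝ (Fin (m + 1))) = m + 1 := by simp
  have hD := hK.isCharDecomposition hrank hb
  -- The derivative along the unit vector is `‖b‖⁻¹ * w`, so `k = q * ‖b‖` is the scale for which
  -- `k² ‖‖b‖⁻¹ w‖² = q² ‖w‖²`; the hypothesis on `q` says precisely that `k` is at least the
  -- diameter.
  have hk : ∀ᵐ s ∂((Measure.euclideanHausdorffMeasure m :
      Measure (EuclideanSpace ℝ (Fin (m + 1)))).restrict (inflow b K)),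
      charLength b K s ≤ q * ‖b‖ := by
    have h1 := (hK.exists_characteristic_decomposition hrank hb).1
    rw [inflow_direction hb] at h1
    refine h1.mono fun s hs => hs.2.1.trans ?_
    rwa [inv_mul_le_iff₀ hb0, mul_comm] at hq
  obtain ⟨hex, hall⟩ := hD.trace_equiv hK.isOpen hK.isBounded.measure_lt_top.ne hcC hk hvw.direction
  have hsq : (q * ‖b‖) ^ 2 * (∫ x in K, (‖b‖⁻¹ * w x) ^ 2) = q ^ 2 * ∫ x in K, w x ^ 2 := by
    simp only [mul_pow]
    rw [integral_const_mul]
    field_simp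
  rw [hsq] at hall
  exact ⟨hex, fun g hg => hall g hg⟩
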